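/- **Setting.** Let $\Theta$ be a nonempty compact subset of a real Banach space $\mathfrak B$, let $\mathcal T$ be a nonempty convex subset of a real vector space, let $v:\Theta\times\mathcal T\to\mathbb R$ be such that $\ell(\theta)=\sup_{t\in\mathcal T}v(\theta,t)$ is finite, nonnegative and lower semicontinuous on $\Theta$, and put $\Theta_0=\{\theta\in\Theta:\ell(\theta)=0\}$. For each $n$ let $v_n:\Theta\times\mathcal T\to\mathbb R$ be random (defined on some probability space; no measurability is required), let $r_n\to\infty$, and put $T_n=r_n\inf_{\theta\in\Theta}\sup_{t\in\mathcal T}v_n(\theta,t)$ and $\mathbb G_n=r_n(v_n-v)$. Probabilities and expectations of non-measurable objects, and $o_p$, $O_p$, $\rightsquigarrow$, are understood in the sense of outer probability (Hoffmann-Jørgensen). **Assumptions.** * (A0) Every $\theta\in\Theta_0$ is the centre of a ball whose intersection with $\Theta$ is convex. * (A1) $\mathbb G_n$ takes values in $L^\infty(\Theta\times\mathcal T)$ and converges weakly there to a tight Borel measurable random element $\mathbb G$; moreover $\mathbb G_n$ is asymptotically equicontinuous in probability with respect to a pseudometric $\rho$ on $\Theta\times\mathcal T$: for all $\varepsilon,\eta>0$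 there is $\delta>0$ with $\limsup_n \mathrm P^*(\sup_{\rho(x,y)<\delta}|\mathbb G_n(x)-\mathbb G_n(y)|>\varepsilon)<\eta$. * (A2) There are lower semicontinuous, convex, positive homogeneous functionals $D_{\theta;t}v:\mathfrak B\to\mathbb R$ ($\theta\in\Theta_0$, $t\in\mathcal T$) and a function $f_v(\delta)=o(\delta)$ as $\delta\downarrow0$ such that $$\sup\{|v(\theta',t)-v(\theta,t)-D_{\theta;t}v(\theta'-\theta)|:\theta\in\Theta_0,\ \theta'\in\Theta,\ t\in\mathcal T,\ \|\theta'-\theta\|\le\delta\}=O(f_v(\delta))\quad(\delta\downarrow0),$$ and for all $n$, $\theta\in\Theta_0$, $\theta'\in\Theta$ the map $t\mapsto v_n(\theta,t)+D_{\theta;t}v(\theta'-\theta)$ is almost surely quasi-concave. * (A3) $\mathcal T$ carries a compact topology $\mathcal U$ for which the line segments of $\mathcal T$ are continuous curves (as is the case when $\mathcal U$ is induced by a linear topology), $\rho$ is continuous in the sense that $\rho(y,x)\to0$ as $y\to x$ in the product of the norm topology and $\mathcal U$, and for all $n$, $\theta\in\Theta_0$, $\theta'\in\Theta$ the map $t\mapsto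 D_{\theta;t}v(\theta'-\theta)$ is, and the map $t\mapsto v_n(\theta,t)+D_{\theta;t}v(\theta'-\theta)$ almost surely is, $\mathcal U$-upper semicontinuous. * (A4.1) $v(\theta,\cdot)$ is $\mathcal U$-upper semicontinuous for every $\theta\in\Theta_0$. * (A4.2) Either $f_v$ is right-continuous on $[0,\infty)$ and there are random $\hat\theta_n\in\Theta$ with $f_v(d(\hat\theta_n,\Theta_0))=o_p(r_n^{-1})$ and $\sup_{t}v_n(\hat\theta_n,t)\le\inf_{\theta\in\Theta}\sup_{t}v_n(\theta,t)+o_p(r_n^{-1})$; or every $\theta\in\Theta_0$ is the centre of a ball $B$ such that, for all $t\in\mathcal T$, $v(\cdot,t)$ is convex on $\Theta\cap B$. Define $$\gamma(\theta,t)=\liminf_{\delta\downarrow0}\ \inf_{\theta'\in\Theta,\ \|\theta'-\theta\|\le\delta}\frac{D_{\theta;t}v(\theta'-\theta)}{\delta},$$ $K(\theta)=\{t\in\mathcal T:\gamma(\theta,t)=0\}$ and $\tilde K(\theta)=\{t\in\mathcal T:\gamma(\theta,t)=v(\theta,t)=0\}$. **Theorem 1.** Assume (A0)–(A3). 1. If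 $\Theta_0\ne\emptyset$, then $K(\theta)\neq\emptyset$ for every $\theta\in\Theta_0$, $$T_n\le\inf_{\theta\in\Theta_0}\sup_{t\in K(\theta)}\mathbb G_n(\theta,t)+o_p(1),\qquad \inf_{\theta\in\Theta_0}\sup_{t\in K(\theta)}\mathbb G_n(\theta,t)\rightsquigarrow\inf_{\theta\in\Theta_0}\sup_{t\in K(\theta)}\mathbb G(\theta,t).$$ 2. If $\Theta_0=\emptyset$, then $r_n=O_p(T_n)$. 3. If (A4.1) also holds, then part 1 holds with $K$ replaced by $\tilde K$. 4. If (A4.1) and (A4.2) both hold and $\Theta_0\ne\emptyset$, then $T_n=\inf_{\theta\in\Theta_0}\sup_{t\in\tilde K(\theta)}\mathbb G_n(\theta,t)+o_p(1)\rightsquigarrow\inf_{\theta\in\Theta_0}\sup_{t\in\tilde K(\theta)}\mathbb G(\theta,t)$. -/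

import Mathlib

open Set Filter Topology MeasureTheory

noncomputable section

namespace Minimax

/-! ### Stochastic convergence for maps that need not be measurable

Throughout, `P n A` for a non-measurable set `A` is the outer probability of `A`. -/

/-- Outer expectation of a bounded, possibly non-measurable, real function: the infimum of the
expectations of its integrable measurable majorants. -/
def outerExp {Ω : Type*} [MeasurableSpace Ω] (P : Measure Ω) (g : Ω → ℝ) : ℝ :=
  sInf {c : ℝ | ∃ U : Ω → ℝ, Measurable U ∧ Integrable U P ∧ (∀ ω, g ω ≤ U ω) ∧ c = ∫ ω, U ω ∂P}

/-- Weak convergence `X n ⇝ Y` (in the sense of Hoffmann-Jørgensen) of arbitrary maps `X n` into a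
topological space `S` to a Borel random element `Y`: the outer expectations `E* f(X n)` converge
to `E f(Y)` for every bounded continuous `f : S → ℝ`. -/
def WeakConv {S : Type*} [TopologicalSpace S] {Ω : ℕ → Type*} [∀ n, MeasurableSpace (Ω n)]
    (P : ∀ n, Measure (Ω n)) (X : ∀ n, Ω n → S)
    {Ω' : Type*} [MeasurableSpace Ω'] (Q : Measure Ω') (Y : Ω' → S) : Prop :=
  ∀ f : BoundedContinuousFunction S ℝ,
    Tendsto (fun n => outerExp (P n) (fun ω => f (X n ω))) atTop (𝓝 (∫ ω, f (Y ω) ∂Q))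

/-- `X n = o_p(a n)` (in outer probability). -/
def IsLittleOP {Ω : ℕ → Type*} [∀ n, MeasurableSpace (Ω n)]
    (P : ∀ n, Measure (Ω n)) (X : ∀ n, Ω n → ℝ) (a : ℕ → ℝ) : Prop :=
  ∀ ε : ℝ, 0 < ε → Tendsto (fun n => P n {ω | ε * |a n| < |X n ω|}) atTop (𝓝 0)

/-- `X n = O_p(Y n)` (in outer probability). -/
def IsBigOP {Ω : ℕ → Type*} [∀ n, MeasurableSpace (Ω n)]
    (P : ∀ n, Measure (Ω n)) (X Y : ∀ n, Ω n → ℝ) : Prop :=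
  ∀ ε : ENNReal, 0 < ε → ∃ M : ℝ, ∀ᶠ n in atTop, P n {ω | M * |Y n ω| < |X n ω|} ≤ ε

/-- `X n ≤ Y n + o_p(a n)`. -/
def LeAddOP {Ω : ℕ → Type*} [∀ n, MeasurableSpace (Ω n)]
    (P : ∀ n, Measure (Ω n)) (X Y : ∀ n, Ω n → ℝ) (a : ℕ → ℝ) : Prop :=
  ∃ R : ∀ n, Ω n → ℝ, IsLittleOP P R a ∧ ∀ n ω, X n ω ≤ Y n ω + R n ω

/-- `X n = Y n + o_p(a n)`. -/
def EqAddOP {Ω : ℕ → Type*} [∀ n, MeasurableSpace (Ω n)]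
    (P : ∀ n, Measure (Ω n)) (X Y : ∀ n, Ω n → ℝ) (a : ℕ → ℝ) : Prop :=
  ∃ R : ∀ n, Ω n → ℝ, IsLittleOP P R a ∧ ∀ n ω, X n ω = Y n ω + R n ω

/-- The space `L^∞(Θ, 𝒯)` of bounded real functions on `Θ × 𝒯` with the supremum norm. -/
abbrev LInf {𝔅 E : Type*} (Θ : Set 𝔅) (T : Set E) : Type _ := lp (fun _ : Θ × T => ℝ) ⊤

/-- Asymptotic (uniform) equicontinuity in probability with respect to a pseudometric `ρ`:
for all `ε, η > 0` there is `δ > 0` with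
`limsup P*(sup_{ρ(x,y) < δ} |G n x - G n y| > ε) < η`. -/
def AsympEquicont {𝔅 E : Type*} {Θ : Set 𝔅} {T : Set E} {Ω : ℕ → Type*}
    [∀ n, MeasurableSpace (Ω n)] (P : ∀ n, Measure (Ω n)) (G : ∀ n, Ω n → LInf Θ T)
    (ρ : PseudoMetric (Θ × T) ℝ) : Prop :=
  ∀ ε : ℝ, 0 < ε → ∀ η : ENNReal, 0 < η → ∃ δ : ℝ, 0 < δ ∧
    limsup (fun n => P n {ω | ∃ x y : Θ × T, ρ x y < δ ∧ ε < |G n ω x - G n ω y|}) atTop < η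

/-! ### The minimax model -/

/-- The population criterion `ℓ(θ) = sup_{t ∈ 𝒯} v(θ, t)`. -/
def criterion {𝔅 E : Type*} (T : Set E) (v : 𝔅 → E → ℝ) (θ : 𝔅) : ℝ := ⨆ t : T, v θ t

/-- The identified set `Θ₀ = {θ ∈ Θ : ℓ(θ) = 0}`. -/
def identifiedSet {𝔅 E : Type*} (Θ : Set 𝔅) (T : Set E) (v : 𝔅 → E → ℝ) : Set 𝔅 :=
  {θ | θ ∈ Θ ∧ criterion T v θ = 0}

/-- The statistic `T_n = r_n inf_{θ ∈ Θ} sup_{t ∈ 𝒯} v_n(θ, t)`. -/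
def stat {𝔅 E : Type*} (Θ : Set 𝔅) (T : Set E) (r : ℕ → ℝ) {Ω : ℕ → Type*}
    (vn : ∀ n, Ω n → 𝔅 → E → ℝ) (n : ℕ) (ω : Ω n) : ℝ :=
  r n * ⨅ θ : Θ, ⨆ t : T, vn n ω θ t

/-- Every segment between two points of `𝒯` lies in `𝒯` and is a continuous curve for the given
topology on `𝒯`. This holds in particular for the topology induced on a convex set by any linear
topology on `E`. -/
def SegmentsContinuous {E : Type*} [AddCommGroup E] [Module ℝ E] (T : Set E)
    [TopologicalSpace T] : Prop :=
  ∀ s t : T, ∃ p : unitInterval → T, Continuous p ∧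
    ∀ a : unitInterval, (p a : E) = (1 - (a : ℝ)) • (s : E) + (a : ℝ) • (t : E)

/-- `D` is positive homogeneous: `D (c h) = c D h` for all `c ≥ 0`. -/
def PosHomogeneous {𝔅 : Type*} [AddCommGroup 𝔅] [Module ℝ 𝔅] (D : 𝔅 → ℝ) : Prop :=
  ∀ (c : ℝ) (h : 𝔅), 0 ≤ c → D (c • h) = c * D h

/-- `γ(θ, t) = liminf_{δ ↓ 0} inf {D_{θ;t}v(θ' - θ) / δ : θ' ∈ Θ, ‖θ' - θ‖ ≤ δ}`, an extended
real number. Here `D θ t` is the functional `D_{θ;t}v`. -/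
def gamma {𝔅 E : Type*} [NormedAddCommGroup 𝔅] (Θ : Set 𝔅) (D : 𝔅 → E → 𝔅 → ℝ)
    (θ : 𝔅) (t : E) : EReal :=
  liminf (fun δ : ℝ => ⨅ θ' : {θ' : 𝔅 // θ' ∈ Θ ∧ ‖θ' - θ‖ ≤ δ},
    ((D θ t (θ' - θ) / δ : ℝ) : EReal)) (𝓝[>] 0)

/-- `K(θ) = {t ∈ 𝒯 : γ(θ, t) = 0}`. -/
def K {𝔅 E : Type*} [NormedAddCommGroup 𝔅] (Θ : Set 𝔅) (T : Set E) (D : 𝔅 → E → 𝔅 → ℝ)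
    (θ : 𝔅) : Set T :=
  {t | gamma Θ D θ t = 0}

/-- `K̃(θ) = {t ∈ 𝒯 : γ(θ, t) = v(θ, t) = 0}`. -/
def Ktilde {𝔅 E : Type*} [NormedAddCommGroup 𝔅] (Θ : Set 𝔅) (T : Set E) (v : 𝔅 → E → ℝ)
    (D : 𝔅 → E → 𝔅 → ℝ) (θ : 𝔅) : Set T :=
  {t | gamma Θ D θ t = 0 ∧ v θ t = 0}

/-- The functional `g ↦ inf_{θ ∈ Θ₀} sup_{t ∈ A(θ)} g(θ, t)` on `L^∞(Θ, 𝒯)`. -/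
def infSup {𝔅 E : Type*} {Θ : Set 𝔅} {T : Set E} (Θ₀ : Set 𝔅) (A : 𝔅 → Set T)
    (g : LInf Θ T) : ℝ :=
  ⨅ θ : {θ : Θ // (θ : 𝔅) ∈ Θ₀}, ⨆ t : A (θ : Θ), g ((θ : Θ), (t : T))

end Minimax

end

/-! Upper bound. Fix `θ ∈ Θ₀` and look at `Θ` only at the points `θ + (c / r_n) h`, with `h` in the
convex set of displacements that stay in `Θ` and in a small ball. There `r_n v_n(·, t)` is uniformly
close to `r_n (v_n(θ, t) + D_{θ;t}v((c / r_n) h))`: asymptotic equicontinuity controls the change of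
`G_n`, and the linearization error is `r_n o(1 / r_n)`. This expression is convex in `h`, and
quasi-concave and upper semicontinuous in `t`, so the minimax theorem
`exists_forall_le_of_lt_inf_sup` gives a single `t` that is good for all `h`. At `h = 0`, since
`v(θ, ·) ≤ 0`, it gives `G_n(θ, t) ≥ T_n - small`. Since `ℓ ≥ 0` and `G_n` is bounded in
probability, the same `t` has `v(θ, t) ≥ -O(1 / r_n)` and `D_{θ;t}v ≥ -O(1 / c)` near `θ`, so it is
almost active once `c` is large (`exists_almostActive_ge`). By compactness the almost active indices
shrink to `K(θ)`, or to `K̃(θ)` if `v(θ, ·)` is upper semicontinuous, and equicontinuity moves `t`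
into that set, which is therefore nonempty. The slices `{θ} × K(θ)` are totally bounded
(`exists_finite_approx`), so finitely many `θ` control the infimum over `Θ₀`.

Lower bound. A near minimizer lies close to `Θ₀` with high probability, because `ℓ` is bounded away
from zero elsewhere. For a nearest point `θ` of `Θ₀` and `t ∈ K̃(θ)`, split `r_n v_n` at the near
minimizer into `G_n`, which is close to `G_n(θ, t)`, and `r_n v`, which is at least `-o(1)` by the
rate condition or by convexity of `v` (`tendsto_stat_add_lt_infSup`).

Limits. The functional `infSup` is Lipschitz on `L^∞`, so continuous mapping and Slutsky's lemma
apply. If `Θ₀` is empty, `ℓ ≥ m > 0` and `T_n ≥ m r_n - ‖G_n‖`. -/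

namespace Minimax

/-! ### A minimax inequality with connected superlevel sets -/

/-- If the superlevel sets at the two endpoints were disjoint, each connected superlevel set in
between, being covered by them, would lie in exactly one. Semicontinuity in `u` makes both
alternatives closed, which would disconnect the interval. -/
theorem exists_le_endpoints {X : Type*} [TopologicalSpace X] {φ : unitInterval → X → ℝ} {S : Set X}
    {α β : ℝ} (hαβ : α < β) (hlsc : ∀ x, LowerSemicontinuous fun u => φ u x)
    (hquasi : ∀ u x, φ u x ≤ max (φ 0 x) (φ 1 x))
    (hclosed : ∀ u, IsClosed {x | x ∈ S ∧ α ≤ φ u x})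
    (hconn : ∀ u, IsPreconnected {x | x ∈ S ∧ α ≤ φ u x})
    (hne : ∀ u, ∃ x ∈ S, β ≤ φ u x) : ∃ x ∈ S, α ≤ φ 0 x ∧ α ≤ φ 1 x := by
  by_contra! hcon
  set A : unitInterval → Set X := fun u => {x | x ∈ S ∧ α ≤ φ u x} with hA
  have hcover : ∀ u, A u ⊆ A 0 ∪ A 1 := by
    rintro u x ⟨hxS, hx⟩
    rcases le_max_iff.1 (hx.trans (hquasi u x)) with h | h
    exacts [Or.inl ⟨hxS, h⟩, Or.inr ⟨hxS, h⟩]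
  have hdisj : ∀ x, x ∈ A 0 → x ∈ A 1 → False := fun x h0 h1 =>
    absurd h1.2 (not_le.2 (hcon x h0.1 h0.2))
  have hAne : ∀ u, (A u).Nonempty := fun u => by
    obtain ⟨x, hxS, hx⟩ := hne u
    exact ⟨x, hxS, hαβ.le.trans hx⟩
  have hnot : ∀ u, ¬ ((A u ∩ A 0).Nonempty ∧ (A u ∩ A 1).Nonempty) := by
    rintro u ⟨h0, h1⟩
    obtain ⟨x, -, hx0, hx1⟩ := isPreconnected_closed_iff.1 (hconn u) (A 0) (A 1) (hclosed 0)
      (hclosed 1) (hcover u) h0 h1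
    exact hdisj x hx0 hx1
  have hsub0 : ∀ u, (A u ∩ A 0).Nonempty → A u ⊆ A 0 := fun u h x hx =>
    (hcover u hx).elim id fun h1 => absurd ⟨h, ⟨x, hx, h1⟩⟩ (hnot u)
  have hsub1 : ∀ u, (A u ∩ A 1).Nonempty → A u ⊆ A 1 := fun u h x hx =>
    (hcover u hx).elim (fun h1 => absurd ⟨⟨x, hx, h1⟩, h⟩ (hnot u)) id
  have hclos : ∀ i : unitInterval, (∀ u, (A u ∩ A i).Nonempty → A u ⊆ A i) →
      IsClosed {u | A u ⊆ A i} := by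
    intro i hi
    refine isClosed_of_closure_subset fun u hu => hi u ?_
    -- The gap `α < β` enters here: a point at level `β` for `u` is still strictly above `α` for
    -- nearby parameters.
    obtain ⟨x, hxS, hx⟩ := hne u
    obtain ⟨w, hw, hwi⟩ := ((mem_closure_iff_frequently.1 hu).and_eventually
      (hlsc x u α (hαβ.trans_le hx))).exists
    exact ⟨x, ⟨hxS, hαβ.le.trans hx⟩, hw ⟨hxS, hwi.le⟩⟩
  obtain ⟨u, -, hu0, hu1⟩ := isPreconnected_closed_iff.1 (isPreconnected_univ (α := unitInterval))
    {u | A u ⊆ A 0} {u | A u ⊆ A 1} (hclos 0 hsub0) (hclos 1 hsub1)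
    (fun u _ => by
      obtain ⟨x, hx⟩ := hAne u
      exact (hcover u hx).imp (fun h => hsub0 u ⟨x, hx, h⟩) fun h => hsub1 u ⟨x, hx, h⟩)
    ⟨0, mem_univ _, Subset.refl (A 0)⟩ ⟨1, mem_univ _, Subset.refl (A 1)⟩
  obtain ⟨x, hx⟩ := hAne u
  exact hdisj x (hu0 hx) (hu1 hx)

/-- If `f` is convex and lower semicontinuous in its first argument, and finite intersections of its
superlevel sets in the second, compact, argument are closed and connected, then each
`α < inf_h sup_x f h x` is a lower bound of `f · x` for some `x`. -/
theorem exists_forall_le_of_lt_inf_sup {V X : Type*} [NormedAddCommGroup V] [NormedSpace ℝ V]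
    [TopologicalSpace X] [CompactSpace X] {H : Set V} {f : V → X → ℝ} (hHne : H.Nonempty)
    (hlsc : ∀ x, LowerSemicontinuousOn (fun h => f h x) H)
    (hconv : ∀ x, ConvexOn ℝ H fun h => f h x)
    (husc : ∀ h ∈ H, UpperSemicontinuous (f h))
    (hconn : ∀ s : Set V, s ⊆ H → ∀ α : ℝ, IsPreconnected {x | ∀ h ∈ s, α ≤ f h x})
    {α β : ℝ} (hαβ : α < β) (hsup : ∀ h ∈ H, ∃ x, β ≤ f h x) : ∃ x, ∀ h ∈ H, α ≤ f h x := by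
  have hHconv : Convex ℝ H := by
    obtain ⟨h, hh⟩ := hHne
    obtain ⟨x, -⟩ := hsup h hh
    exact (hconv x).1
  have hcl : ∀ (α : ℝ) (s : Set V), s ⊆ H → IsClosed {x | ∀ h ∈ s, α ≤ f h x} := by
    intro α s hs
    simp only [ofPred_forall]
    exact isClosed_iInter fun h => isClosed_iInter fun hh =>
      (upperSemicontinuous_iff_isClosed_preimage.1 (husc h (hs hh)) α)
  -- The free extra point `h` makes the induction work: when `a` is added, the hypothesis is
  -- available at every point of the segment from `h` to `a`. Each step spends half of the gap
  -- between `α` and `β`.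
  have key : ∀ s : Finset V, (s : Set V) ⊆ H → ∀ α < β, ∀ h ∈ H,
      ∃ x, (∀ k ∈ s, α ≤ f k x) ∧ α ≤ f h x := by
    classical
    intro s
    induction s using Finset.induction_on with
    | empty =>
      intro _ α hα h hh
      obtain ⟨x, hx⟩ := hsup h hh
      exact ⟨x, by simp, hα.le.trans hx⟩
    | insert a s _ ih =>
      intro hs α hα h hh
      have haH : a ∈ H := hs (by simp)
      have hsH : (s : Set V) ⊆ H := fun k hk => hs (by simp [Finset.mem_coe.1 hk])
      have hmem : ∀ u : unitInterval, AffineMap.lineMap h a (u : ℝ) ∈ H := fun u =>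
        hHconv.lineMap_mem hh haH u.2
      have hset : ∀ u : unitInterval, {x | (x ∈ {x | ∀ k ∈ (s : Set V), α ≤ f k x}) ∧
          α ≤ f (AffineMap.lineMap h a (u : ℝ)) x} =
          {x | ∀ k ∈ insert (AffineMap.lineMap h a (u : ℝ)) (s : Set V), α ≤ f k x} := by
        intro u; ext x; simp [and_comm]
      have hsub : ∀ u : unitInterval,
          insert (AffineMap.lineMap h a (u : ℝ)) (s : Set V) ⊆ H := fun u =>
        insert_subset (hmem u) hsH
      obtain ⟨x, hxs, hx0, hx1⟩ := exists_le_endpoints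
        (φ := fun u : unitInterval => f (AffineMap.lineMap h a (u : ℝ)))
        (S := {x | ∀ k ∈ (s : Set V), α ≤ f k x}) (α := α) (β := (α + β) / 2) (by linarith)
        (fun x => by
          have hc : Continuous fun u : unitInterval => (AffineMap.lineMap h a (u : ℝ) : V) :=
            AffineMap.lineMap_continuous.comp continuous_subtype_val
          intro u y hy
          have := hlsc x _ (hmem u) y hy
          exact (tendsto_nhdsWithin_iff.2 ⟨hc.tendsto u, Eventually.of_forall hmem⟩).eventually this)
        (fun u x => by
          have hseg : AffineMap.lineMap h a (u : ℝ) ∈ segment ℝ h a := by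
            rw [segment_eq_image_lineMap]; exact ⟨u, u.2, rfl⟩
          simpa using (hconv x).le_on_segment hh haH hseg)
        (fun u => by rw [hset]; exact hcl α _ (hsub u))
        (fun u => by rw [hset]; exact hconn _ (hsub u) α)
        (fun u => by
          obtain ⟨x, hx, hx'⟩ := ih hsH ((α + β) / 2) (by linarith) _ (hmem u)
          exact ⟨x, fun k hk => by linarith [hx k hk], hx'⟩)
      refine ⟨x, fun k hk => ?_, by simpa using hx0⟩
      rcases Finset.mem_insert.1 hk with rfl | hk
      · simpa using hx1
      · exact hxs k hk
  obtain ⟨h₀, hh₀⟩ := hHne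
  have := CompactSpace.iInter_nonempty (X := X) (t := fun h : H => {x | α ≤ f h x})
    (fun h => upperSemicontinuous_iff_isClosed_preimage.1 (husc h h.2) α)
    (fun u => by
      classical
      obtain ⟨x, hx, -⟩ := key (u.map ⟨_, Subtype.val_injective⟩) (by intro k; simp; tauto) α hαβ
        h₀ hh₀
      exact ⟨x, by simpa using hx⟩)
  obtain ⟨x, hx⟩ := this
  exact ⟨x, fun h hh => mem_iInter.1 hx ⟨h, hh⟩⟩

/-- An intersection of superlevel sets of quasi-concave functions is connected when segments
are continuous curves. -/
theorem isPreconnected_superlevel {E : Type*} [AddCommGroup E] [Module ℝ E] {T : Set E}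
    [TopologicalSpace T] (hseg : SegmentsContinuous T) {ι : Type*} {f : ι → E → ℝ} {s : Set ι}
    (hf : ∀ i ∈ s, QuasiconcaveOn ℝ T (f i)) (α : ℝ) :
    IsPreconnected {t : T | ∀ i ∈ s, α ≤ f i t} := by
  refine isPreconnected_of_forall_pair fun x hx y hy => ?_
  obtain ⟨p, hp, hpe⟩ := hseg x y
  refine ⟨range p, ?_, ⟨0, ?_⟩, ⟨1, ?_⟩, isPreconnected_range hp⟩
  · rintro _ ⟨a, rfl⟩ i hi
    have := hf i hi α ⟨x.2, hx i hi⟩ ⟨y.2, hy i hi⟩ (sub_nonneg.2 a.2.2) a.2.1 (by ring)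
    rw [hpe]
    exact this.2
  · exact Subtype.ext (by simp [hpe])
  · exact Subtype.ext (by simp [hpe])

/-! ### Outer expectations and weak convergence -/

section OuterExp

variable {Ω : Type*} [MeasurableSpace Ω] {P : Measure Ω} [IsProbabilityMeasure P]

theorem outerExp_le_integral {g U : Ω → ℝ} {B : ℝ} (hg : ∀ ω, B ≤ g ω) (hU : Measurable U)
    (hUi : Integrable U P) (hgU : ∀ ω, g ω ≤ U ω) : outerExp P g ≤ ∫ ω, U ω ∂P := by
  refine csInf_le ⟨B, ?_⟩ ⟨U, hU, hUi, hgU, rfl⟩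
  rintro c ⟨V, -, hVi, hgV, rfl⟩
  calc B = ∫ _, B ∂P := by simp
    _ ≤ ∫ ω, V ω ∂P := integral_mono (integrable_const _) hVi fun ω => (hg ω).trans (hgV ω)

theorem exists_integral_lt_outerExp_add {g : Ω → ℝ} {B : ℝ} (hg : ∀ ω, g ω ≤ B) {ε : ℝ}
    (hε : 0 < ε) : ∃ U : Ω → ℝ, Measurable U ∧ Integrable U P ∧ (∀ ω, g ω ≤ U ω) ∧
      ∫ ω, U ω ∂P < outerExp P g + ε := by
  have hne : {c : ℝ | ∃ U : Ω → ℝ, Measurable U ∧ Integrable U P ∧ (∀ ω, g ω ≤ U ω) ∧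
      c = ∫ ω, U ω ∂P}.Nonempty :=
    ⟨_, fun _ => B, measurable_const, integrable_const _, hg, rfl⟩
  obtain ⟨c, ⟨U, h1, h2, h3, rfl⟩, hlt⟩ := exists_lt_of_csInf_lt hne (lt_add_of_pos_right _ hε)
  exact ⟨U, h1, h2, h3, hlt⟩

/-- Markov's inequality for outer expectations. -/
theorem measure_le_outerExp {g : Ω → ℝ} {B : ℝ} (hg0 : ∀ ω, 0 ≤ g ω) (hgB : ∀ ω, g ω ≤ B)
    {A : Set Ω} (hA : ∀ ω ∈ A, 1 ≤ g ω) : P.real A ≤ outerExp P g := by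
  refine le_of_forall_pos_le_add fun ε hε => ?_
  obtain ⟨U, -, hUi, hgU, hlt⟩ := exists_integral_lt_outerExp_add (P := P) hgB hε
  refine le_trans ?_ hlt.le
  have h := mul_meas_ge_le_integral_of_nonneg (μ := P)
    (Eventually.of_forall fun ω => (hg0 ω).trans (hgU ω)) hUi 1
  rw [one_mul] at h
  exact (measureReal_mono fun ω hω => (hA ω hω).trans (hgU ω)).trans h

/-- Outer expectations of functions that are close off a set of small outer probability. -/
theorem outerExp_le_of_le_off {g g' : Ω → ℝ} {B ε : ℝ} (hg : ∀ ω, |g ω| ≤ B)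
    (hg' : ∀ ω, |g' ω| ≤ B) {A : Set Ω} (h : ∀ ω, ω ∉ A → g ω ≤ g' ω + ε) (hε : 0 ≤ ε) :
    outerExp P g ≤ outerExp P g' + ε + 2 * B * P.real A := by
  rcases isEmpty_or_nonempty Ω with hΩ | ⟨⟨ω₀⟩⟩
  · exact absurd (measure_univ (μ := P)) (by simp [univ_eq_empty_iff.2 hΩ])
  have hB : 0 ≤ B := (abs_nonneg _).trans (hg ω₀)
  refine le_of_forall_pos_le_add fun κ hκ => ?_
  obtain ⟨U, hU, hUi, hgU, hlt⟩ := exists_integral_lt_outerExp_add (P := P)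
    (fun ω => (abs_le.1 (hg' ω)).2) hκ
  -- The measurable hull has the same outer probability as `A`. Adding `2 * B` on it turns a
  -- majorant of `g'` into one of `g`.
  have hm := measurableSet_toMeasurable P A
  have hIi : Integrable ((toMeasurable P A).indicator fun _ => 2 * B) P :=
    (integrable_const _).indicator hm
  have := outerExp_le_integral (P := P) (g := g)
    (U := fun ω => U ω + ε + (toMeasurable P A).indicator (fun _ => 2 * B) ω)
    (fun ω => (abs_le.1 (hg ω)).1) ((hU.add_const _).add (measurable_const.indicator hm))
    ((hUi.add (integrable_const _)).add hIi) (fun ω => by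
      by_cases hω : ω ∈ toMeasurable P A
      · simp only [hω, indicator_of_mem]
        linarith [hgU ω, abs_le.1 (hg ω), abs_le.1 (hg' ω)]
      · simp only [hω, not_false_eq_true, indicator_of_notMem]
        linarith [hgU ω, h ω fun h' => hω (subset_toMeasurable P A h')])
  rw [integral_add (f := fun ω => U ω + ε) (hUi.add (integrable_const _)) hIi, integral_add hUi (integrable_const _),
    integral_indicator hm] at this
  simp only [integral_const, smul_eq_mul, measureReal_restrict_apply MeasurableSet.univ,
    univ_inter, probReal_univ, one_mul] at this
  have h2 : P.real (toMeasurable P A) = P.real A := by simp [measureReal_def]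
  rw [h2] at this
  linarith

end OuterExp

/-! ### Calculus of outer probability, continuous mapping and Slutsky's lemma. -/

section Stochastic

variable {Ω : ℕ → Type*} [∀ n, MeasurableSpace (Ω n)] {P : ∀ n, Measure (Ω n)}

theorem tendsto_measure_zero_of_subset {A B : ∀ n, Set (Ω n)}
    (hB : Tendsto (fun n => P n (B n)) atTop (𝓝 0)) (h : ∀ᶠ n in atTop, A n ⊆ B n) :
    Tendsto (fun n => P n (A n)) atTop (𝓝 0) :=
  tendsto_of_tendsto_of_tendsto_of_le_of_le' tendsto_const_nhds hB (Eventually.of_forall fun _ =>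
    zero_le) (h.mono fun _ hn => measure_mono hn)

theorem tendsto_measure_zero_union {A B : ∀ n, Set (Ω n)}
    (hA : Tendsto (fun n => P n (A n)) atTop (𝓝 0))
    (hB : Tendsto (fun n => P n (B n)) atTop (𝓝 0)) :
    Tendsto (fun n => P n (A n ∪ B n)) atTop (𝓝 0) :=
  tendsto_of_tendsto_of_tendsto_of_le_of_le tendsto_const_nhds (by simpa using hA.add hB)
    (fun _ => zero_le) fun _ => measure_union_le _ _

/-- To prove convergence to zero it suffices to control `A n` off sets of asymptotically small outer
probability. -/
theorem tendsto_measure_zero_of_forall {A : ∀ n, Set (Ω n)}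
    (h : ∀ η : ENNReal, 0 < η → ∃ B : ∀ n, Set (Ω n), (∀ᶠ n in atTop, P n (B n) ≤ η) ∧
      Tendsto (fun n => P n (A n \ B n)) atTop (𝓝 0)) :
    Tendsto (fun n => P n (A n)) atTop (𝓝 0) := by
  rw [ENNReal.tendsto_nhds_zero]
  intro η hη
  obtain ⟨B, hB, hAB⟩ := h (η / 2) (ENNReal.half_pos hη.ne')
  filter_upwards [hB, ENNReal.tendsto_nhds_zero.1 hAB (η / 2) (ENNReal.half_pos hη.ne')]
    with n h1 h2
  calc P n (A n) ≤ P n (A n \ B n ∪ B n) := measure_mono (by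
        rw [sdiff_union_self]; exact subset_union_left)
    _ ≤ P n (A n \ B n) + P n (B n) := measure_union_le _ _
    _ ≤ η / 2 + η / 2 := add_le_add h2 h1
    _ = η := ENNReal.add_halves η

theorem leAddOP_of_tendsto {X Y : ∀ n, Ω n → ℝ}
    (h : ∀ ε : ℝ, 0 < ε → Tendsto (fun n => P n {ω | Y n ω + ε < X n ω}) atTop (𝓝 0)) :
    LeAddOP P X Y fun _ => 1 := by
  refine ⟨fun n ω => max (X n ω - Y n ω) 0, fun ε hε => ?_, fun n ω => ?_⟩
  · refine tendsto_measure_zero_of_subset (h ε hε) (Eventually.of_forall fun n ω hω => ?_)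
    simp only [mem_ofPred_eq, abs_one, mul_one, abs_of_nonneg (le_max_right _ (0 : ℝ))] at hω ⊢
    rcases lt_max_iff.1 hω with h | h <;> linarith
  · linarith [le_max_left (X n ω - Y n ω) 0]

theorem tendsto_of_leAddOP {X Y : ∀ n, Ω n → ℝ} {a : ℕ → ℝ} (h : LeAddOP P X Y a) {ε : ℝ}
    (hε : 0 < ε) : Tendsto (fun n => P n {ω | Y n ω + ε * |a n| < X n ω}) atTop (𝓝 0) := by
  obtain ⟨R, hR, hXY⟩ := h
  refine tendsto_measure_zero_of_subset (hR ε hε) (Eventually.of_forall fun n ω hω => ?_)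
  simp only [mem_ofPred_eq] at hω ⊢
  exact (show ε * |a n| < R n ω by linarith [hXY n ω]).trans_le (le_abs_self _)

theorem eqAddOP_of_tendsto {X Y : ∀ n, Ω n → ℝ}
    (h₁ : ∀ ε : ℝ, 0 < ε → Tendsto (fun n => P n {ω | Y n ω + ε < X n ω}) atTop (𝓝 0))
    (h₂ : ∀ ε : ℝ, 0 < ε → Tendsto (fun n => P n {ω | X n ω + ε < Y n ω}) atTop (𝓝 0)) :
    EqAddOP P X Y fun _ => 1 := by
  refine ⟨fun n ω => X n ω - Y n ω, fun ε hε => ?_, fun n ω => by ring⟩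
  refine tendsto_measure_zero_of_subset (tendsto_measure_zero_union (h₁ ε hε) (h₂ ε hε))
    (Eventually.of_forall fun n ω hω => ?_)
  simp only [mem_ofPred_eq, abs_one, mul_one, mem_union] at hω ⊢
  rcases lt_abs.1 hω with h | h
  exacts [Or.inl (by linarith), Or.inr (by linarith)]

/-- The continuous mapping theorem. -/
theorem WeakConv.comp {S S' : Type*} [TopologicalSpace S] [TopologicalSpace S']
    {X : ∀ n, Ω n → S} {Ω' : Type*} [MeasurableSpace Ω'] {Q : Measure Ω'} {Y : Ω' → S}
    (h : WeakConv P X Q Y) {φ : S → S'} (hφ : Continuous φ) :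
    WeakConv P (fun n ω => φ (X n ω)) Q fun ω => φ (Y ω) := fun f =>
  h (f.compContinuous ⟨φ, hφ⟩)

variable [∀ n, IsProbabilityMeasure (P n)]

/-- A weakly convergent sequence is bounded in outer probability. -/
theorem WeakConv.exists_norm_le {S : Type*} [NormedAddCommGroup S] [MeasurableSpace S]
    [BorelSpace S] {X : ∀ n, Ω n → S} {Ω' : Type*} [MeasurableSpace Ω'] {Q : Measure Ω'}
    [IsProbabilityMeasure Q] {Y : Ω' → S} (hY : Measurable Y) (h : WeakConv P X Q Y)
    {η : ENNReal} (hη : 0 < η) : ∃ L : ℝ, 0 < L ∧ ∀ᶠ n in atTop, P n {ω | L < ‖X n ω‖} ≤ η := by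
  -- Continuous cutoffs, zero for `‖g‖ ≤ k` and one for `‖g‖ ≥ k + 1`. Their expectations at `Y`
  -- vanish as `k` grows, and weak convergence carries this over to `X n`.
  let φ : ℕ → S → ℝ := fun k g => max 0 (min 1 (‖g‖ - k))
  have hφc : ∀ k, Continuous (φ k) := fun k => by fun_prop
  have hφ0 : ∀ k g, 0 ≤ φ k g := fun k g => le_max_left _ _
  have hφ1 : ∀ k g, φ k g ≤ 1 := fun k g => max_le zero_le_one (min_le_left _ _)
  have hlim : Tendsto (fun k : ℕ => ∫ ω, φ k (Y ω) ∂Q) atTop (𝓝 (∫ _, (0 : ℝ) ∂Q)) := by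
    refine tendsto_integral_of_dominated_convergence (fun _ => 1)
      (fun k => ((hφc k).measurable.comp hY).aestronglyMeasurable) (integrable_const _)
      (fun k => Eventually.of_forall fun ω => ?_) (Eventually.of_forall fun ω => ?_)
    · rw [Real.norm_of_nonneg (hφ0 _ _)]; exact hφ1 _ _
    · refine tendsto_const_nhds.congr' ?_
      filter_upwards [eventually_ge_atTop ⌈‖Y ω‖⌉₊] with k hk
      have : ‖Y ω‖ ≤ k := (Nat.le_ceil _).trans (by exact_mod_cast hk)
      exact (max_eq_left ((min_le_right _ _).trans (by linarith))).symm
  rw [integral_zero] at hlim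
  obtain ⟨η', hη'0, hη'⟩ : ∃ η' : ℝ, 0 < η' ∧ ENNReal.ofReal η' ≤ η := by
    obtain ⟨q, hq0, hq⟩ := ENNReal.lt_iff_exists_nnreal_btwn.1 hη
    exact ⟨q, by exact_mod_cast hq0, by simpa using hq.le⟩
  obtain ⟨k, hk⟩ := (hlim.eventually_lt_const hη'0).exists
  refine ⟨k + 1, by positivity, ?_⟩
  have hW := h (BoundedContinuousFunction.ofNormedAddCommGroup (φ k) (hφc k) 1 fun g => by
    rw [Real.norm_of_nonneg (hφ0 _ _)]; exact hφ1 _ _)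
  filter_upwards [hW.eventually_lt_const hk] with n hn
  refine le_trans ?_ hη'
  rw [← ofReal_measureReal]
  refine ENNReal.ofReal_le_ofReal (le_trans ?_ hn.le)
  refine measure_le_outerExp (fun ω => hφ0 _ _) (fun ω => hφ1 _ _) fun ω hω => ?_
  simp only [mem_ofPred_eq] at hω
  exact le_max_of_le_right (le_min le_rfl (by linarith))

/-- Slutsky's lemma. -/
theorem WeakConv.of_eqAddOP {X Y : ∀ n, Ω n → ℝ} {Ω' : Type*} [MeasurableSpace Ω']
    {Q : Measure Ω'} [IsProbabilityMeasure Q] {Z : Ω' → ℝ} (hZ : Measurable Z)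
    (h : WeakConv P Y Q Z) (hXY : EqAddOP P X Y fun _ => 1) : WeakConv P X Q Z := by
  intro f
  have hf : ∀ x, |f x| ≤ ‖f‖ := fun x => f.norm_coe_le_norm x
  have hclose : ∀ ε : ℝ, 0 < ε → ∃ A : ∀ n, Set (Ω n), (∀ᶠ n in atTop, (P n).real (A n) ≤ ε) ∧
      ∀ n, ∀ ω ∉ A n, |f (X n ω) - f (Y n ω)| ≤ ε := by
    intro ε hε
    have hη : 0 < ENNReal.ofReal (ε / 2) := by simpa using hε
    obtain ⟨L, hL, hYL⟩ := h.exists_norm_le hZ hη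
    obtain ⟨R, hR, hRe⟩ := hXY
    have huc := (isCompact_Icc (a := -(L + 1)) (b := L + 1)).uniformContinuousOn_of_continuous
      f.continuous.continuousOn
    obtain ⟨δ, hδ, hfδ⟩ := Metric.uniformContinuousOn_iff.1 huc ε hε
    -- Off this set both variables lie in `[-(L + 1), L + 1]`, where `f` is uniformly continuous,
    -- and are less than `δ` apart.
    refine ⟨fun n => {ω | L < ‖Y n ω‖} ∪ {ω | min (δ / 2) 1 * |(1 : ℝ)| < |R n ω|}, ?_, ?_⟩
    · filter_upwards [hYL, ENNReal.tendsto_nhds_zero.1 (hR (min (δ / 2) 1) (by positivity)) _ hη]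
        with n h1 h2
      refine ENNReal.toReal_le_of_le_ofReal hε.le ((measure_union_le _ _).trans
        ((add_le_add h1 h2).trans ?_))
      rw [← ENNReal.ofReal_add (by positivity) (by positivity), add_halves]
    · intro n ω hω
      simp only [mem_union, mem_ofPred_eq, not_or, not_lt, abs_one, mul_one, Real.norm_eq_abs]
        at hω
      obtain ⟨h1, h2⟩ := hω
      have h3 := h2.trans (min_le_left _ _)
      have h4 := h2.trans (min_le_right _ _)
      rw [abs_le] at h1 h4
      have hX := hRe n ω
      refine (hfδ (X n ω) ⟨by linarith, by linarith⟩ (Y n ω) ⟨by linarith, by linarith⟩ ?_).le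
      rw [Real.dist_eq, hX, add_sub_cancel_left]
      linarith
  refine tendsto_of_tendsto_of_dist (h f) ?_
  rw [Metric.tendsto_atTop']
  intro ε hε
  -- Chosen so that the total error `κ + 2 * ‖f‖ * κ` equals `ε / 2`.
  set κ := ε / (2 * (1 + 2 * ‖f‖)) with hκ
  have hκ0 : 0 < κ := by positivity
  obtain ⟨A, hA, hAf⟩ := hclose κ hκ0
  obtain ⟨N, hN⟩ := eventually_atTop.1 hA
  refine ⟨N, fun n hn => ?_⟩
  have e1 := outerExp_le_of_le_off (P := P n) (fun ω => hf (X n ω)) (fun ω => hf (Y n ω))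
    (A := A n) (ε := κ) (fun ω hω => by linarith [(abs_le.1 (hAf n ω hω)).2]) hκ0.le
  have e2 := outerExp_le_of_le_off (P := P n) (fun ω => hf (Y n ω)) (fun ω => hf (X n ω))
    (A := A n) (ε := κ) (fun ω hω => by linarith [(abs_le.1 (hAf n ω hω)).1]) hκ0.le
  have e3 : 2 * ‖f‖ * (P n).real (A n) ≤ 2 * ‖f‖ * κ :=
    mul_le_mul_of_nonneg_left (hN n hn.le) (by positivity)
  have e4 : κ + 2 * ‖f‖ * κ = ε / 2 := by rw [hκ]; field_simp
  rw [Real.dist_eq, sub_zero, Real.dist_eq, abs_abs, abs_sub_lt_iff]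
  constructor <;> linarith

end Stochastic

/-! ### Sublinear functionals and the sets of active indices -/

theorem PosHomogeneous.map_zero {𝔅 : Type*} [AddCommGroup 𝔅] [Module ℝ 𝔅] {D : 𝔅 → ℝ}
    (hD : PosHomogeneous D) : D 0 = 0 := by
  simpa using hD 0 0 le_rfl

/-- A lower semicontinuous sublinear functional on a Banach space is continuous. -/
theorem continuous_of_sublinear {𝔅 : Type*} [NormedAddCommGroup 𝔅] [NormedSpace ℝ 𝔅]
    [CompleteSpace 𝔅] {D : 𝔅 → ℝ} (hlsc : LowerSemicontinuous D) (hconv : ConvexOn ℝ univ D)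
    (hhom : PosHomogeneous D) : Continuous D := by
  have hadd : ∀ x y, D (x + y) ≤ D x + D y := by
    intro x y
    have h1 := hconv.2 (mem_univ x) (mem_univ y) (show (0 : ℝ) ≤ 1 / 2 by norm_num)
      (show (0 : ℝ) ≤ 1 / 2 by norm_num) (by norm_num)
    have h2 := hhom 2 ((1 / 2 : ℝ) • x + (1 / 2 : ℝ) • y) (by norm_num)
    rw [smul_add, smul_smul, smul_smul] at h2
    norm_num at h1 h2
    linarith
  -- Symmetrizing gives a lower semicontinuous seminorm, continuous because Banach spaces are
  -- barrelled. Hence `D x ≤ C * ‖x‖`, and subadditivity turns this into a Lipschitz bound.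
  let p : Seminorm ℝ 𝔅 := Seminorm.of (fun x => max (D x) (D (-x)))
    (fun x y => max_le
      ((hadd x y).trans (add_le_add (le_max_left _ _) (le_max_left _ _)))
      (by
        rw [neg_add]
        exact (hadd _ _).trans (add_le_add (le_max_right _ _) (le_max_right _ _))))
    (fun a x => by
      rcases le_total 0 a with ha | ha
      · rw [Real.norm_of_nonneg ha, ← smul_neg, hhom a _ ha, hhom a _ ha, mul_max_of_nonneg _ _ ha]
      · have e1 : a • x = (-a) • (-x) := by simp
        have e2 : -(a • x) = (-a) • x := by simp
        rw [Real.norm_of_nonpos ha, e2, e1, hhom _ _ (neg_nonneg.2 ha), hhom _ _ (neg_nonneg.2 ha),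
          mul_max_of_nonneg _ _ (neg_nonneg.2 ha), max_comm])
  have hp : Continuous p := Seminorm.continuous_of_lowerSemicontinuous (𝕜 := ℝ) p
    (hlsc.sup (hlsc.comp continuous_neg))
  obtain ⟨C, hC, hpC⟩ := Seminorm.bound_of_continuous_normedSpace p hp
  have hDC : ∀ x, D x ≤ C * ‖x‖ := fun x => (le_max_left _ _).trans (hpC x)
  refine (LipschitzWith.of_dist_le_mul (K := C.toNNReal) fun x y => ?_).continuous
  rw [Real.dist_eq, dist_eq_norm, abs_sub_le_iff]
  have h1 := hadd (x - y) y
  have h2 := hadd (y - x) x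
  rw [sub_add_cancel] at h1 h2
  have h3 := hDC (y - x)
  rw [norm_sub_rev] at h3
  have h4 := hDC (x - y)
  rw [Real.coe_toNNReal C hC.le]
  constructor <;> linarith

theorem quasiconcaveOn_of_tendsto {E ι : Type*} [AddCommGroup E] [Module ℝ E] {T : Set E}
    {l : Filter ι} [l.NeBot] {F : ι → E → ℝ} {f : E → ℝ} (hT : Convex ℝ T)
    (hF : ∀ᶠ i in l, QuasiconcaveOn ℝ T (F i)) (h : ∀ t ∈ T, Tendsto (fun i => F i t) l (𝓝 (f t))) :
    QuasiconcaveOn ℝ T f := by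
  rintro c x ⟨hx, hcx⟩ y ⟨hy, hcy⟩ a b ha hb hab
  have hz := hT hx hy ha hb hab
  refine ⟨hz, (le_min hcx hcy).trans ?_⟩
  refine le_of_tendsto_of_tendsto ((h x hx).min (h y hy)) (h _ hz) (hF.mono fun i hi => ?_)
  exact (hi (min (F i x) (F i y)) ⟨hx, min_le_left _ _⟩ ⟨hy, min_le_right _ _⟩ ha hb hab).2

/-- Almost sure quasi-concavity for each point of a separable set holds for all points at once. -/
theorem ae_forall_quasiconcaveOn {𝔅 E Ω : Type*} [NormedAddCommGroup 𝔅] [AddCommGroup E]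
    [Module ℝ E] [MeasurableSpace Ω] {P : Measure Ω} {Θ : Set 𝔅} {T : Set E} (hΘ : IsCompact Θ)
    (hT : Convex ℝ T) {w : Ω → E → ℝ} {D : E → 𝔅 → ℝ} (hD : ∀ t ∈ T, Continuous (D t)) (θ : 𝔅)
    (h : ∀ θ' ∈ Θ, ∀ᵐ ω ∂P, QuasiconcaveOn ℝ T fun t => w ω t + D t (θ' - θ)) :
    ∀ᵐ ω ∂P, ∀ θ' ∈ Θ, QuasiconcaveOn ℝ T fun t => w ω t + D t (θ' - θ) := by
  obtain ⟨c, hcΘ, hc, hΘc⟩ := hΘ.isSeparable.exists_countable_dense_subset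
  have : ∀ᵐ ω ∂P, ∀ θ' ∈ c, QuasiconcaveOn ℝ T fun t => w ω t + D t (θ' - θ) :=
    (ae_ball_iff hc).2 fun θ' hθ' => h θ' (hcΘ hθ')
  filter_upwards [this] with ω hω θ' hθ'
  have := mem_closure_iff_nhdsWithin_neBot.1 (hΘc hθ')
  refine quasiconcaveOn_of_tendsto (l := 𝓝[c] θ')
    (F := fun k t => w ω t + D t (k - θ)) hT (eventually_nhdsWithin_of_forall hω) fun t ht => ?_
  exact (tendsto_const_nhds.add (((hD t ht).comp (continuous_id.sub continuous_const)).tendsto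
    θ')).mono_left nhdsWithin_le_nhds

/-! ### Active and almost active indices near a point. -/

section Local

variable {𝔅 E : Type*} [NormedAddCommGroup 𝔅] [NormedSpace ℝ 𝔅] {Θ : Set 𝔅} {T : Set E}
  {v : 𝔅 → E → ℝ} {D : 𝔅 → E → 𝔅 → ℝ} {θ : 𝔅} {ε : ℝ}

theorem add_smul_mem_inter_ball (hε : 0 < ε) (hθ : θ ∈ Θ) (hconv : Convex ℝ (Θ ∩ Metric.ball θ ε))
    {h : 𝔅} (hh : θ + h ∈ Θ ∩ Metric.ball θ ε) {s : ℝ} (hs0 : 0 ≤ s) (hs1 : s ≤ 1) :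
    θ + s • h ∈ Θ ∩ Metric.ball θ ε := by
  have := hconv ⟨hθ, Metric.mem_ball_self hε⟩ hh (sub_nonneg.2 hs1) hs0 (by ring)
  convert this using 1
  module

/-- By local convexity a displacement can be shrunk to any smaller length `δ` inside `Θ`, and by
homogeneity its quotient with `δ` does not change. A negative value thus persists in the limit;
without one, the infimum is zero, attained at `θ` itself. -/
theorem gamma_eq_zero_iff (hε : 0 < ε) (hθ : θ ∈ Θ) (hconv : Convex ℝ (Θ ∩ Metric.ball θ ε)) {t : E}
    (hD : PosHomogeneous (D θ t)) :
    gamma Θ D θ t = 0 ↔ ∀ θ' ∈ Θ ∩ Metric.ball θ ε, 0 ≤ D θ t (θ' - θ) := by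
  constructor
  · intro hγ θ' hθ'
    by_contra! hneg
    have hd : 0 < ‖θ' - θ‖ := norm_pos_iff.2 fun h0 => by simp [h0, hD.map_zero] at hneg
    have hle : gamma Θ D θ t ≤ ((D θ t (θ' - θ) / ‖θ' - θ‖ : ℝ) : EReal) := by
      have hev : ∀ᶠ δ : ℝ in 𝓝[>] 0, (⨅ θ' : {θ' : 𝔅 // θ' ∈ Θ ∧ ‖θ' - θ‖ ≤ δ},
          ((D θ t (θ' - θ) / δ : ℝ) : EReal)) ≤ ((D θ t (θ' - θ) / ‖θ' - θ‖ : ℝ) : EReal) := by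
        filter_upwards [Ioc_mem_nhdsGT hd] with δ hδ
        have hs0 : 0 ≤ δ / ‖θ' - θ‖ := by have := hδ.1; positivity
        have hmem := add_smul_mem_inter_ball hε hθ hconv (h := θ' - θ) (by simpa using hθ') hs0
          ((div_le_one hd).2 hδ.2)
        refine iInf_le_of_le ⟨_, hmem.1, ?_⟩ (le_of_eq ?_)
        · rw [add_sub_cancel_left, norm_smul, Real.norm_of_nonneg hs0, div_mul_cancel₀ _ hd.ne']
        · have := hδ.1.ne'
          simp only [add_sub_cancel_left, hD _ _ hs0]
          congr 1
          field_simp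
      exact (liminf_le_liminf hev).trans (liminf_const _).le
    rw [hγ] at hle
    exact absurd (EReal.coe_nonneg.1 hle) (not_le.2 (div_neg_of_neg_of_pos hneg hd))
  · intro h
    have hev : ∀ᶠ δ : ℝ in 𝓝[>] 0, (⨅ θ' : {θ' : 𝔅 // θ' ∈ Θ ∧ ‖θ' - θ‖ ≤ δ},
        ((D θ t (θ' - θ) / δ : ℝ) : EReal)) = 0 := by
      filter_upwards [Ioo_mem_nhdsGT hε] with δ hδ
      refine le_antisymm (iInf_le_of_le ⟨θ, hθ, by simpa using hδ.1.le⟩ (by simp [hD.map_zero]))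
        (le_iInf fun θ' => EReal.coe_nonneg.2 (div_nonneg (h θ' ⟨θ'.2.1, ?_⟩) hδ.1.le))
      rw [mem_ball_iff_norm]
      exact θ'.2.2.trans_lt hδ.2
    exact (liminf_congr hev).trans (liminf_const _)

/-- The indices at which `v θ` and the functional `D θ` on the part of `Θ` near `θ` are at least
`-η`. -/
def almostActive (Θ : Set 𝔅) (T : Set E) (v : 𝔅 → E → ℝ) (D : 𝔅 → E → 𝔅 → ℝ) (θ : 𝔅) (ε η : ℝ) :
    Set T :=
  {t | -η ≤ v θ t ∧ ∀ θ' ∈ Θ ∩ Metric.ball θ ε, -η ≤ D θ t (θ' - θ)}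

variable [TopologicalSpace T] [CompactSpace T]

/-- Only the condition on `D` is kept, so no semicontinuity of `v` is needed: these closed subsets
of a compact space decrease to `K(θ)`, and one of them lies in `U`. -/
theorem exists_almostActive_subset_of_K (hε : 0 < ε) (hθ : θ ∈ Θ)
    (hconv : Convex ℝ (Θ ∩ Metric.ball θ ε)) (hD : ∀ t ∈ T, PosHomogeneous (D θ t))
    (husc : ∀ θ' ∈ Θ, UpperSemicontinuous fun t : T => D θ t (θ' - θ)) {U : Set T}
    (hU : ∀ t ∈ K Θ T D θ, U ∈ 𝓝 t) : ∃ η > 0, almostActive Θ T v D θ ε η ⊆ U := by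
  let V : Ioi (0 : ℝ) → Set T := fun η => {t | ∀ θ' ∈ Θ ∩ Metric.ball θ ε, -η ≤ D θ t (θ' - θ)}
  have hV : ∀ η, IsClosed (V η) := fun η => by
    simp only [V, ofPred_forall]
    exact isClosed_iInter fun θ' => isClosed_iInter fun hθ' =>
      upperSemicontinuous_iff_isClosed_preimage.1 (husc θ' hθ'.1) (-η)
  obtain ⟨η, hη⟩ := exists_subset_nhds_of_isCompact' (V := V) (U := U)
    (fun a b => ⟨⟨min a b, mem_Ioi.2 (lt_min a.2 b.2)⟩,
      fun t ht θ' hθ' => (neg_le_neg (min_le_left _ _)).trans (ht θ' hθ'),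
      fun t ht θ' hθ' => (neg_le_neg (min_le_right _ _)).trans (ht θ' hθ')⟩)
    (fun η => (hV η).isCompact) hV (fun t ht => hU t
      ((gamma_eq_zero_iff hε hθ hconv (hD t t.2)).2 fun θ' hθ' =>
        le_of_forall_pos_le_add fun κ hκ => by
          linarith [show -κ ≤ D θ t (θ' - θ) from mem_iInter.1 ht ⟨κ, hκ⟩ θ' hθ']))
  exact ⟨η, η.2, fun t ht => hη ht.2⟩

/-- With `v θ` upper semicontinuous the almost active sets are themselves closed; since `v θ ≤ 0`,
their intersection is `K̃(θ)`. -/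
theorem exists_almostActive_subset_of_Ktilde (hε : 0 < ε) (hθ : θ ∈ Θ)
    (hconv : Convex ℝ (Θ ∩ Metric.ball θ ε)) (hD : ∀ t ∈ T, PosHomogeneous (D θ t))
    (husc : ∀ θ' ∈ Θ, UpperSemicontinuous fun t : T => D θ t (θ' - θ))
    (hv : UpperSemicontinuous fun t : T => v θ t) (hv0 : ∀ t ∈ T, v θ t ≤ 0) {U : Set T}
    (hU : ∀ t ∈ Ktilde Θ T v D θ, U ∈ 𝓝 t) : ∃ η > 0, almostActive Θ T v D θ ε η ⊆ U := by
  let V : Ioi (0 : ℝ) → Set T := fun η => almostActive Θ T v D θ ε η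
  have hV : ∀ η, IsClosed (V η) := fun η => by
    simp only [V, almostActive, ofPred_and, ofPred_forall]
    exact (upperSemicontinuous_iff_isClosed_preimage.1 hv (-η)).inter <|
      isClosed_iInter fun θ' => isClosed_iInter fun hθ' =>
        upperSemicontinuous_iff_isClosed_preimage.1 (husc θ' hθ'.1) (-η)
  obtain ⟨η, hη⟩ := exists_subset_nhds_of_isCompact' (V := V) (U := U)
    (fun a b => ⟨⟨min a b, mem_Ioi.2 (lt_min a.2 b.2)⟩,
      fun t ht => ⟨(neg_le_neg (min_le_left _ _)).trans ht.1,
        fun θ' hθ' => (neg_le_neg (min_le_left _ _)).trans (ht.2 θ' hθ')⟩,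
      fun t ht => ⟨(neg_le_neg (min_le_right _ _)).trans ht.1,
        fun θ' hθ' => (neg_le_neg (min_le_right _ _)).trans (ht.2 θ' hθ')⟩⟩)
    (fun η => (hV η).isCompact) hV (fun t ht => hU t
      ⟨(gamma_eq_zero_iff hε hθ hconv (hD t t.2)).2 fun θ' hθ' =>
        le_of_forall_pos_le_add fun κ hκ => by
          linarith [show -κ ≤ D θ t (θ' - θ) from (mem_iInter.1 ht ⟨κ, hκ⟩).2 θ' hθ'],
        le_antisymm (hv0 t t.2) (le_of_forall_pos_le_add fun κ hκ => by
          linarith [show -κ ≤ v θ t from (mem_iInter.1 ht ⟨κ, hκ⟩).1])⟩)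
  exact ⟨η, η.2, hη⟩

end Local

/-! ### Continuous pseudometrics on compact spaces -/

section Pseudometric

variable {X : Type*} [TopologicalSpace X] {ρ : PseudoMetric X ℝ}

theorem continuous_pseudoMetric (hρ : ∀ x, Tendsto (fun y => ρ y x) (𝓝 x) (𝓝 0)) :
    Continuous fun q : X × X => ρ q.1 q.2 := by
  refine continuous_iff_continuousAt.2 fun ⟨a, b⟩ => ?_
  refine tendsto_iff_dist_tendsto_zero.2 ?_
  have h : Tendsto (fun q : X × X => ρ q.1 a + ρ q.2 b) (𝓝 (a, b)) (𝓝 0) := by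
    simpa using ((hρ a).comp (continuous_fst.tendsto (a, b))).add
      ((hρ b).comp (continuous_snd.tendsto (a, b)))
  refine squeeze_zero (fun _ => dist_nonneg) (fun q => ?_) h
  rw [Real.dist_eq, abs_sub_le_iff]
  have h1 := ρ.triangle q.1 a q.2
  have h2 := ρ.triangle a b q.2
  have h3 := ρ.triangle a q.1 b
  have h4 := ρ.triangle q.1 q.2 b
  rw [ρ.symm b q.2] at h2
  rw [ρ.symm a q.1] at h3
  constructor <;> linarith

/-- The tube lemma gives uniformity in `t`; on compact `Θ`, neighbourhoods of the diagonal are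
entourages, which gives uniformity in `θ`. -/
theorem exists_uniform_pseudoMetric_lt {𝔅 Y : Type*} [SeminormedAddCommGroup 𝔅] {Θ : Set 𝔅}
    (hΘ : IsCompact Θ) [TopologicalSpace Y] [CompactSpace Y] {ρ : PseudoMetric (Θ × Y) ℝ}
    (hρ : ∀ x, Tendsto (fun y => ρ y x) (𝓝 x) (𝓝 0)) {δ : ℝ} (hδ : 0 < δ) :
    ∃ κ > 0, ∀ θ θ' : Θ, ‖(θ' : 𝔅) - θ‖ < κ → ∀ t, ρ (θ', t) (θ, t) < δ := by
  have := isCompact_iff_compactSpace.1 hΘ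
  have hmem : {p : Θ × Θ | ∀ t ∈ (univ : Set Y), ρ (p.2, t) (p.1, t) < δ} ∈ uniformity Θ := by
    rw [← nhdsSet_diagonal_eq_uniformity, mem_nhdsSet_iff_forall]
    rintro ⟨θ, θ'⟩ h
    obtain rfl : θ = θ' := h
    refine isCompact_univ.eventually_forall_of_forall_eventually fun t _ => ?_
    have hc : Continuous fun z : (Θ × Θ) × Y => ρ (z.1.2, z.2) (z.1.1, z.2) :=
      (continuous_pseudoMetric hρ).comp (f := fun z : (Θ × Θ) × Y => ((z.1.2, z.2), (z.1.1, z.2)))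
        (by fun_prop)
    exact (hc.tendsto ((θ, θ), t)).eventually_lt_const (by simpa using hδ)
  obtain ⟨κ, hκ, h⟩ := Metric.mem_uniformity_dist.1 hmem
  refine ⟨κ, hκ, fun θ θ' hθ t => h (a := θ) (b := θ') ?_ t (mem_univ _)⟩
  rwa [dist_comm, Subtype.dist_eq, dist_eq_norm]

/-- The subsets of a compact space are totally bounded for the Hausdorff distance. -/
theorem exists_finite_approx [CompactSpace X]
    (hρ : ∀ x, Tendsto (fun y => ρ y x) (𝓝 x) (𝓝 0)) {ι : Type*} (B : ι → Set X) {δ : ℝ}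
    (hδ : 0 < δ) : ∃ F : Set ι, F.Finite ∧ ∀ i, ∃ j ∈ F, ∀ y ∈ B j, ∃ x ∈ B i, ρ y x < δ := by
  obtain ⟨N, hN⟩ := CompactSpace.elim_nhds_subcover (fun z : X => {x | ρ x z < δ / 2})
    fun z => (hρ z).eventually_lt_const (half_pos hδ)
  -- Each `B i` is recorded by the points of a finite net that it comes close to. There are finitely
  -- many records, and one representative of each suffices.
  let σ : ι → Set N := fun i => {z | ∃ x ∈ B i, ρ x z < δ / 2}
  refine ⟨range fun s : range σ => s.2.choose, finite_range _, fun i => ?_⟩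
  refine ⟨_, ⟨⟨σ i, i, rfl⟩, rfl⟩, fun y hy => ?_⟩
  have hσ : σ (show σ i ∈ range σ from ⟨i, rfl⟩).choose = σ i :=
    (show σ i ∈ range σ from ⟨i, rfl⟩).choose_spec
  obtain ⟨z, hzN, hz⟩ : ∃ z ∈ N, ρ y z < δ / 2 := by
    have : y ∈ ⋃ x ∈ N, {y | ρ y x < δ / 2} := by rw [hN]; trivial
    simpa using this
  have hmem : (⟨z, hzN⟩ : N) ∈ σ i := by
    rw [← hσ]
    exact ⟨y, hy, hz⟩
  obtain ⟨x, hx, hxz⟩ := hmem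
  refine ⟨x, hx, ?_⟩
  have h1 := ρ.triangle y z x
  rw [ρ.symm z x] at h1
  simp only at hxz
  linarith

end Pseudometric

/-! ### The functional `infSup` -/

section InfSup

variable {𝔅 E : Type*} {Θ : Set 𝔅} {T : Set E} {Θ₀ : Set 𝔅} {A : 𝔅 → Set T}

theorem abs_apply_le_norm (g : LInf Θ T) (x : Θ × T) : |g x| ≤ ‖g‖ :=
  lp.norm_apply_le_norm (by simp) g x

theorem bddAbove_range_apply (g : LInf Θ T) {ι : Sort*} (x : ι → Θ × T) :
    BddAbove (range fun i => g (x i)) :=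
  ⟨‖g‖, by rintro _ ⟨i, rfl⟩; exact (abs_le.1 (abs_apply_le_norm g _)).2⟩

theorem infSup_le (hA : ∀ θ ∈ Θ₀, θ ∈ Θ → (A θ).Nonempty) (g : LInf Θ T) (θ : Θ)
    (hθ : (θ : 𝔅) ∈ Θ₀) : infSup Θ₀ A g ≤ ⨆ t : A θ, g (θ, t) := by
  refine ciInf_le (f := fun θ : {θ : Θ // (θ : 𝔅) ∈ Θ₀} => ⨆ t : A (θ : Θ), g ((θ : Θ), (t : T)))
    ⟨-‖g‖, ?_⟩ ⟨θ, hθ⟩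
  rintro _ ⟨θ', rfl⟩
  obtain ⟨t, ht⟩ := hA θ' θ'.2 θ'.1.2
  exact (abs_le.1 (abs_apply_le_norm g _)).1.trans
    (le_ciSup (f := fun t : A (θ' : Θ) => g ((θ' : Θ), (t : T)))
      (bddAbove_range_apply g fun t : A (θ' : Θ) => ((θ' : Θ), (t : T))) ⟨t, ht⟩)

theorem le_infSup (hne : ∃ θ ∈ Θ₀, θ ∈ Θ) {g : LInf Θ T} {c : ℝ}
    (h : ∀ θ : Θ, (θ : 𝔅) ∈ Θ₀ → c ≤ ⨆ t : A θ, g (θ, t)) : c ≤ infSup Θ₀ A g := by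
  obtain ⟨θ, hθ₀, hθ⟩ := hne
  have : Nonempty {θ : Θ // (θ : 𝔅) ∈ Θ₀} := ⟨⟨⟨θ, hθ⟩, hθ₀⟩⟩
  exact le_ciInf fun θ => h θ θ.2

theorem infSup_mono (hne : ∃ θ ∈ Θ₀, θ ∈ Θ) (hA : ∀ θ ∈ Θ₀, θ ∈ Θ → (A θ).Nonempty)
    {g g' : LInf Θ T} {c : ℝ} (h : ∀ x, g x ≤ g' x + c) :
    infSup Θ₀ A g ≤ infSup Θ₀ A g' + c := by
  rw [← sub_le_iff_le_add]
  refine le_infSup hne fun θ hθ => ?_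
  rw [sub_le_iff_le_add]
  refine (infSup_le hA g θ hθ).trans ?_
  obtain ⟨t, ht⟩ := hA θ hθ θ.2
  have : Nonempty (A θ) := ⟨⟨t, ht⟩⟩
  refine ciSup_le fun t => (h _).trans ?_
  gcongr
  exact le_ciSup (f := fun t : A θ => g' (θ, (t : T)))
    (bddAbove_range_apply g' fun t : A θ => (θ, (t : T))) t

theorem continuous_infSup (hne : ∃ θ ∈ Θ₀, θ ∈ Θ) (hA : ∀ θ ∈ Θ₀, θ ∈ Θ → (A θ).Nonempty) :
    Continuous (infSup Θ₀ A : LInf Θ T → ℝ) := by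
  refine (LipschitzWith.of_le_add fun g g' => infSup_mono hne hA fun x => ?_).continuous
  have := (abs_le.1 (abs_apply_le_norm (g - g') x)).2
  rw [lp.coeFn_sub, Pi.sub_apply] at this
  rw [dist_eq_norm]
  linarith

end InfSup

/-! ### The minimax value of a perturbed criterion -/

section Perturbation

variable {𝔅 E : Type*} {Θ : Set 𝔅} {T : Set E} {v w : 𝔅 → E → ℝ} {g : LInf Θ T} {R : ℝ}

theorem mul_eq_add (hg : ∀ x : Θ × T, g x = R * (w x.1 x.2 - v x.1 x.2)) (x : Θ × T) :
    R * w x.1 x.2 = R * v x.1 x.2 + g x := by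
  rw [hg]; ring

/-- Real suprema and infima of unbounded families take a default value. This lemma and
`bddBelow_perturbed` ensure that those in the statistic are genuine. -/
theorem bddAbove_perturbed (hR : 0 < R) (hg : ∀ x : Θ × T, g x = R * (w x.1 x.2 - v x.1 x.2))
    (hv : ∀ θ ∈ Θ, BddAbove (range fun t : T => v θ t)) (θ : Θ) :
    BddAbove (range fun t : T => w θ t) := by
  obtain ⟨M, hM⟩ := hv θ θ.2
  refine ⟨M + ‖g‖ / R, ?_⟩
  rintro _ ⟨t, rfl⟩
  have h1 := mul_eq_add hg (θ, t)
  have h2 := (abs_le.1 (abs_apply_le_norm g (θ, t))).2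
  have h3 : v θ t ≤ M := hM ⟨t, rfl⟩
  refine le_of_mul_le_mul_left ?_ hR
  rw [mul_add, mul_div_cancel₀ _ hR.ne']
  simp only at h1 ⊢
  nlinarith

theorem mul_criterion_sub_norm_le [Nonempty T] (hR : 0 < R)
    (hg : ∀ x : Θ × T, g x = R * (w x.1 x.2 - v x.1 x.2))
    (hv : ∀ θ ∈ Θ, BddAbove (range fun t : T => v θ t)) (θ : Θ) :
    R * criterion T v θ - ‖g‖ ≤ R * ⨆ t : T, w θ t := by
  have : criterion T v θ ≤ (R * (⨆ t : T, w θ t) + ‖g‖) / R := by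
    refine ciSup_le fun t => ?_
    rw [le_div_iff₀ hR, mul_comm]
    have h1 := mul_eq_add hg (θ, t)
    have h2 := (abs_le.1 (abs_apply_le_norm g (θ, t))).1
    have h3 := mul_le_mul_of_nonneg_left
      (le_ciSup (f := fun t : T => w θ t) (bddAbove_perturbed hR hg hv θ) t) hR.le
    simp only at h1 h3
    linarith
  rw [le_div_iff₀ hR] at this
  linarith

theorem bddBelow_perturbed [Nonempty T] (hR : 0 < R)
    (hg : ∀ x : Θ × T, g x = R * (w x.1 x.2 - v x.1 x.2))
    (hv : ∀ θ ∈ Θ, BddAbove (range fun t : T => v θ t))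
    (hl : ∀ θ ∈ Θ, 0 ≤ criterion T v θ) :
    BddBelow (range fun θ : Θ => ⨆ t : T, w θ t) := by
  refine ⟨-‖g‖ / R, ?_⟩
  rintro _ ⟨θ, rfl⟩
  rw [div_le_iff₀ hR, mul_comm]
  have h1 := mul_criterion_sub_norm_le hR hg hv θ
  have h2 := mul_nonneg hR.le (hl θ θ.2)
  linarith

theorem le_zero_of_mem_identifiedSet (hv : ∀ θ ∈ Θ, BddAbove (range fun t : T => v θ t)) {θ : 𝔅}
    (hθ : θ ∈ identifiedSet Θ T v) {t : E} (ht : t ∈ T) : v θ t ≤ 0 := by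
  rw [← hθ.2]
  exact le_ciSup (f := fun t : T => v θ t) (hv θ hθ.1) ⟨t, ht⟩

/-- The minimax value of `w` is, up to small errors, at most the value of the perturbation at some
almost active index. -/
theorem exists_almostActive_ge [NormedAddCommGroup 𝔅] [NormedSpace ℝ 𝔅] [AddCommGroup E]
    [Module ℝ E] [TopologicalSpace T] [CompactSpace T] [Nonempty T] (hseg : SegmentsContinuous T)
    {D : 𝔅 → E → 𝔅 → ℝ} {θ : 𝔅} {c ε e κ m L η : ℝ}
    (hv : ∀ θ ∈ Θ, BddAbove (range fun t : T => v θ t)) (hl : ∀ θ ∈ Θ, 0 ≤ criterion T v θ)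
    (hθ : θ ∈ identifiedSet Θ T v) (hε : 0 < ε) (hconv : Convex ℝ (Θ ∩ Metric.ball θ ε))
    (hDc : ∀ t ∈ T, Continuous (D θ t)) (hDconv : ∀ t ∈ T, ConvexOn ℝ univ (D θ t))
    (hDhom : ∀ t ∈ T, PosHomogeneous (D θ t))
    (hDusc : ∀ θ' ∈ Θ, UpperSemicontinuous fun t : T => D θ t (θ' - θ))
    (hg : ∀ x : Θ × T, g x = R * (w x.1 x.2 - v x.1 x.2)) (hgL : ‖g‖ ≤ L)
    (hqc : ∀ θ' ∈ Θ, QuasiconcaveOn ℝ T fun t => w θ t + D θ t (θ' - θ))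
    (hwusc : UpperSemicontinuous fun t : T => w θ t) (hR : 0 < R) (hc : 0 < c) (hcR : c ≤ R)
    (happrox : ∀ θ' ∈ Θ, ∀ t ∈ T, ‖θ' - θ‖ ≤ c / R * ε →
      R * |v θ' t - v θ t - D θ t (θ' - θ)| ≤ e)
    (hmod : ∀ θ' : Θ, ‖(θ' : 𝔅) - θ‖ ≤ c / R * ε → ∀ t : T, |g (θ', t) - g (⟨θ, hθ.1⟩, t)| ≤ m)
    (hκ : 0 < κ) (hηc : 2 * L + 2 * κ + e ≤ η * c) (hηR : 2 * L + 2 * κ + e ≤ η * R) :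
    ∃ t ∈ almostActive Θ T v D θ ε η,
      R * (⨅ θ' : Θ, ⨆ t : T, w θ' t) - (2 * κ + e + m) ≤ g (⟨θ, hθ.1⟩, t) := by
  set s := c / R with hs
  have hs0 : 0 < s := by positivity
  have hs1 : s ≤ 1 := (div_le_one hR).2 hcR
  set H : Set 𝔅 := {h | θ + h ∈ Θ ∩ Metric.ball θ ε} with hH
  have h0H : (0 : 𝔅) ∈ H := by
    rw [hH, mem_ofPred_eq, add_zero]; exact ⟨hθ.1, Metric.mem_ball_self hε⟩
  have hmem : ∀ h ∈ H, θ + s • h ∈ Θ := fun h hh =>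
    (add_smul_mem_inter_ball hε hθ.1 hconv hh hs0.le hs1).1
  have hnorm : ∀ h ∈ H, ‖θ + s • h - θ‖ ≤ s * ε := fun h hh => by
    have := hh.2
    rw [mem_ball_iff_norm, add_sub_cancel_left] at this
    rw [add_sub_cancel_left, norm_smul, Real.norm_of_nonneg hs0.le]
    gcongr
  have hHconv : Convex ℝ H := by
    have := hconv.translate_preimage_right θ
    exact this
  set I := ⨅ θ' : Θ, ⨆ t : T, w θ' t with hI
  let f : 𝔅 → T → ℝ := fun h t => w θ t + D θ t (s • h)
  have hf : ∀ h (t : T), R * f h t = R * v θ t + g (⟨θ, hθ.1⟩, t) + R * D θ t (s • h) := by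
    intro h t
    have := mul_eq_add hg (⟨θ, hθ.1⟩, t)
    simp only [f, mul_add] at this ⊢
    rw [this]
  have hgb : ∀ x, -L ≤ g x ∧ g x ≤ L := fun x =>
    abs_le.1 ((abs_apply_le_norm g x).trans hgL)
  have happ : ∀ h ∈ H, ∀ t : T, R * v (θ + s • h) t - R * v θ t - e ≤ R * D θ t (s • h) := by
    intro h hh t
    have h1 := happrox _ (hmem h hh) t t.2 (hnorm h hh)
    rw [add_sub_cancel_left] at h1
    have h2 := mul_le_mul_of_nonneg_left
      (le_abs_self (v (θ + s • h) t - v θ t - D θ t (s • h))) hR.le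
    linarith
  -- Two lower bounds for the supremum of `f h`: this one, through the value `I`, bounds `g` at the
  -- selected index; the next, through `ℓ ≥ 0`, makes that index almost active. Taking their maximum
  -- lets one `t` serve both.
  have hA : ∀ h ∈ H, ∃ t, (R * I - κ - e - m) / R ≤ f h t := by
    intro h hh
    have hlt : I - κ / R < ⨆ t : T, w (θ + s • h) t := by
      have : I ≤ ⨆ t : T, w (θ + s • h) t :=
        ciInf_le (bddBelow_perturbed hR hg hv hl) ⟨_, hmem h hh⟩
      have h2 : 0 < κ / R := by positivity
      linarith
    obtain ⟨t, ht⟩ := exists_lt_of_lt_ciSup hlt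
    refine ⟨t, ?_⟩
    rw [div_le_iff₀ hR, mul_comm (f h t), hf]
    have h1 := mul_eq_add hg (⟨_, hmem h hh⟩, t)
    have h2 := mul_lt_mul_of_pos_left ht hR
    rw [mul_sub, mul_div_cancel₀ _ hR.ne'] at h2
    have h3 := (abs_le.1 (hmod ⟨_, hmem h hh⟩ (hnorm h hh) t)).2
    have h4 := happ h hh t
    simp only at h1
    linarith
  have hB : ∀ h ∈ H, ∃ t, (-κ - e - L) / R ≤ f h t := by
    intro h hh
    have hlt : -(κ / R) < ⨆ t : T, v (θ + s • h) t :=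
      (neg_lt_zero.2 (by positivity)).trans_le (hl _ (hmem h hh))
    obtain ⟨t, ht⟩ := exists_lt_of_lt_ciSup hlt
    refine ⟨t, ?_⟩
    rw [div_le_iff₀ hR, mul_comm (f h t), hf]
    have h2 := mul_lt_mul_of_pos_left ht hR
    rw [mul_neg, mul_div_cancel₀ _ hR.ne'] at h2
    have h4 := happ h hh t
    linarith [(hgb (⟨θ, hθ.1⟩, t)).1]
  set β := max (R * I - κ - e - m) (-κ - e - L) with hβ
  have hsup : ∀ h ∈ H, ∃ t, β / R ≤ f h t := by
    intro h hh
    rcases max_choice (R * I - κ - e - m) (-κ - e - L) with h1 | h1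
    · rw [hβ, h1]; exact hA h hh
    · rw [hβ, h1]; exact hB h hh
  obtain ⟨t, ht⟩ := exists_forall_le_of_lt_inf_sup (H := H) (f := f) ⟨0, h0H⟩
    (fun t => by
      have := hDc t t.2
      have : Continuous fun h => w θ t + D θ t (s • h) := by fun_prop
      exact this.lowerSemicontinuous.lowerSemicontinuousOn _)
    (fun t => by
      refine (convexOn_const _ hHconv).add (((hDconv t t.2).comp_linearMap
        (LinearMap.lsmul ℝ 𝔅 s)).subset (fun _ _ => mem_univ _) hHconv))
    (fun h hh => by
      have := hDusc _ (hmem h hh)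
      rw [add_sub_cancel_left] at this
      exact hwusc.add this)
    (fun S hS α => isPreconnected_superlevel hseg (f := fun h t => w θ t + D θ t (s • h))
      (fun h hh => by
        have := hqc _ (hmem h (hS hh))
        rwa [add_sub_cancel_left] at this) α)
    (α := (β - κ) / R) (by gcongr; linarith) hsup
  have ht' : ∀ h ∈ H, β - κ ≤ R * v θ t + g (⟨θ, hθ.1⟩, t) + R * D θ t (s • h) := fun h hh => by
    rw [← hf, mul_comm, ← div_le_iff₀ hR]; exact ht h hh
  have hv0 : R * v θ t ≤ 0 :=
    mul_nonpos_of_nonneg_of_nonpos hR.le (le_zero_of_mem_identifiedSet hv hθ t.2)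
  have ht0 := ht' 0 h0H
  rw [smul_zero, (hDhom t t.2).map_zero, mul_zero, add_zero] at ht0
  have hβ1 := le_max_left (R * I - κ - e - m) (-κ - e - L)
  have hβ2 := le_max_right (R * I - κ - e - m) (-κ - e - L)
  rw [← hβ] at hβ1 hβ2
  have hgt := hgb (⟨θ, hθ.1⟩, t)
  refine ⟨t, ⟨?_, fun θ' hθ' => ?_⟩, by linarith⟩
  · refine le_of_mul_le_mul_left ?_ hR
    linarith
  · have h1 := ht' (θ' - θ) (by rw [hH, mem_ofPred_eq, add_sub_cancel]; exact hθ')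
    rw [hDhom t t.2 _ _ hs0.le, ← mul_assoc, hs, mul_div_cancel₀ _ hR.ne'] at h1
    refine le_of_mul_le_mul_left ?_ hc
    linarith

end Perturbation

/-! ### The stochastic upper bound -/

theorem AsympEquicont.exists_eventually_le {𝔅 E : Type*} {Θ : Set 𝔅} {T : Set E} {Ω : ℕ → Type*}
    [∀ n, MeasurableSpace (Ω n)] {P : ∀ n, Measure (Ω n)} {G : ∀ n, Ω n → LInf Θ T}
    {ρ : PseudoMetric (Θ × T) ℝ} (h : AsympEquicont P G ρ) {ε : ℝ} (hε : 0 < ε) {η : ENNReal}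
    (hη : 0 < η) : ∃ δ : ℝ, 0 < δ ∧
      ∀ᶠ n in atTop, P n {ω | ∃ x y : Θ × T, ρ x y < δ ∧ ε < |G n ω x - G n ω y|} ≤ η := by
  obtain ⟨δ, hδ, hlim⟩ := h ε hε η hη
  exact ⟨δ, hδ, (eventually_lt_of_limsup_lt hlim).mono fun _ hn => hn.le⟩

theorem AsympEquicont.exists_compl {𝔅 E : Type*} {Θ : Set 𝔅} {T : Set E} {Ω : ℕ → Type*}
    [∀ n, MeasurableSpace (Ω n)] {P : ∀ n, Measure (Ω n)} {G : ∀ n, Ω n → LInf Θ T}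
    {ρ : PseudoMetric (Θ × T) ℝ} (h : AsympEquicont P G ρ)
    (hb : ∀ η : ENNReal, 0 < η → ∃ L : ℝ, 0 < L ∧ ∀ᶠ n in atTop, P n {ω | L < ‖G n ω‖} ≤ η)
    {ε : ℝ} (hε : 0 < ε) {η : ENNReal} (hη : 0 < η) :
    ∃ L δ : ℝ, 0 < L ∧ 0 < δ ∧ ∃ B : ∀ n, Set (Ω n), (∀ᶠ n in atTop, P n (B n) ≤ η) ∧
      ∀ n, ∀ ω ∉ B n, ‖G n ω‖ ≤ L ∧
        ∀ x y : Θ × T, ρ x y < δ → |G n ω x - G n ω y| ≤ ε := by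
  obtain ⟨δ, hδ, h1⟩ := h.exists_eventually_le hε (ENNReal.half_pos hη.ne')
  obtain ⟨L, hL, h2⟩ := hb _ (ENNReal.half_pos hη.ne')
  refine ⟨L, δ, hL, hδ, fun n => {ω | L < ‖G n ω‖} ∪
    {ω | ∃ x y : Θ × T, ρ x y < δ ∧ ε < |G n ω x - G n ω y|}, ?_, fun n ω hω => ?_⟩
  · filter_upwards [h1, h2] with n h1 h2
    exact (measure_union_le _ _).trans ((add_le_add h2 h1).trans (ENNReal.add_halves η).le)
  · simp only [mem_union, mem_ofPred_eq, not_or, not_lt, not_exists, not_and] at hω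
    exact hω

/-- The linearization error at distance of order `1 / r n` stays negligible after multiplication by
`r n`. -/
theorem eventually_mul_abs_le {r : ℕ → ℝ} (hr : Tendsto r atTop atTop) {f : ℝ → ℝ}
    (hf : f =o[𝓝[>] 0] fun δ : ℝ => δ) (C : ℝ) {a κ : ℝ} (ha : 0 < a) (hκ : 0 < κ) :
    ∀ᶠ n in atTop, r n * (C * |f (a / r n)|) ≤ κ := by
  have hlim : Tendsto (fun n => a / r n) atTop (𝓝[>] 0) := by
    refine tendsto_nhdsWithin_iff.2 ⟨tendsto_const_nhds.div_atTop hr, ?_⟩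
    filter_upwards [hr.eventually_gt_atTop 0] with n hn
    exact div_pos ha hn
  have hpos : 0 < κ / ((|C| + 1) * a) := by positivity
  filter_upwards [hlim.eventually (hf.bound hpos), hr.eventually_gt_atTop 0] with n hn hrn
  rw [Real.norm_eq_abs, Real.norm_of_nonneg (by positivity)] at hn
  calc r n * (C * |f (a / r n)|)
      ≤ r n * ((|C| + 1) * (κ / ((|C| + 1) * a) * (a / r n))) := by
        gcongr
        linarith [le_abs_self C]
    _ = κ := by field_simp

/-! ### The upper bound at one point of the identified set. -/

section Upper

variable {𝔅 E : Type*} [NormedAddCommGroup 𝔅] [NormedSpace ℝ 𝔅] [AddCommGroup E] [Module ℝ E]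
  {Θ : Set 𝔅} {T : Set E} [TopologicalSpace T] [CompactSpace T] [Nonempty T] {v : 𝔅 → E → ℝ}
  {r : ℕ → ℝ} {Ω : ℕ → Type*} [∀ n, MeasurableSpace (Ω n)] {P : ∀ n, Measure (Ω n)}
  {vn : ∀ n, Ω n → 𝔅 → E → ℝ} {Gn : ∀ n, Ω n → LInf Θ T} {ρ : PseudoMetric (Θ × T) ℝ}
  {D : 𝔅 → E → 𝔅 → ℝ} {fv : ℝ → ℝ}

theorem eventually_exists_stat_le (hΘ : IsCompact Θ) (hT : Convex ℝ T)
    (hseg : SegmentsContinuous T)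
    (hv : ∀ θ ∈ Θ, BddAbove (range fun t : T => v θ t)) (hl : ∀ θ ∈ Θ, 0 ≤ criterion T v θ)
    (hr : Tendsto r atTop atTop)
    (hGn : ∀ (n : ℕ) (ω : Ω n) (x : Θ × T), Gn n ω x = r n * (vn n ω x.1 x.2 - v x.1 x.2))
    (hρ : ∀ x : Θ × T, Tendsto (fun y => ρ y x) (𝓝 x) (𝓝 0))
    (hfv : fv =o[𝓝[>] 0] (fun δ : ℝ => δ))
    (happrox : ∃ C : ℝ, ∀ᶠ δ in 𝓝[>] (0 : ℝ), ∀ θ ∈ identifiedSet Θ T v, ∀ θ' ∈ Θ, ∀ t ∈ T,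
      ‖θ' - θ‖ ≤ δ → |v θ' t - v θ t - D θ t (θ' - θ)| ≤ C * |fv δ|)
    {θ : 𝔅} (hθ : θ ∈ identifiedSet Θ T v) {ε : ℝ} (hε : 0 < ε)
    (hconv : Convex ℝ (Θ ∩ Metric.ball θ ε))
    (hDc : ∀ t ∈ T, Continuous (D θ t)) (hDconv : ∀ t ∈ T, ConvexOn ℝ univ (D θ t))
    (hDhom : ∀ t ∈ T, PosHomogeneous (D θ t))
    (hDusc : ∀ θ' ∈ Θ, UpperSemicontinuous fun t : T => D θ t (θ' - θ))
    (hqc : ∀ n : ℕ, ∀ θ' ∈ Θ, ∀ᵐ ω ∂(P n),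
      QuasiconcaveOn ℝ T (fun t => vn n ω θ t + D θ t (θ' - θ)))
    (hvusc : ∀ n : ℕ, ∀ θ' ∈ Θ, ∀ᵐ ω ∂(P n),
      UpperSemicontinuous (fun t : T => vn n ω θ t + D θ t (θ' - θ)))
    {A : Set T} (hA : ∀ U : Set T, (∀ t ∈ A, U ∈ 𝓝 t) → ∃ η > 0, almostActive Θ T v D θ ε η ⊆ U)
    {L δ ε₀ : ℝ} (hL : 0 < L) (hδ : 0 < δ) (hε₀ : 0 < ε₀) :
    ∀ᶠ n in atTop, ∀ᵐ ω ∂(P n), ‖Gn n ω‖ ≤ L →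
      (∀ x y : Θ × T, ρ x y < δ → |Gn n ω x - Gn n ω y| ≤ ε₀) →
      ∃ t ∈ A, stat Θ T r vn n ω ≤ Gn n ω (⟨θ, hθ.1⟩, t) + 5 * ε₀ := by
  obtain ⟨η, hη, hηU⟩ := hA {t | ∃ s ∈ A, ρ (⟨θ, hθ.1⟩, t) (⟨θ, hθ.1⟩, s) < δ} fun s hs => by
    have h1 : Tendsto (fun t : T => ((⟨θ, hθ.1⟩, t) : Θ × T)) (𝓝 s) (𝓝 (⟨θ, hθ.1⟩, s)) :=
      (Continuous.prodMk_right _).tendsto s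
    filter_upwards [((hρ _).comp h1).eventually_lt_const hδ] with t ht
    exact ⟨s, hs, ht⟩
  obtain ⟨κ', hκ', hmod⟩ := exists_uniform_pseudoMetric_lt hΘ hρ hδ
  obtain ⟨C, hC⟩ := happrox
  set κ := min ε₀ 1 with hκ
  have hκ0 : 0 < κ := lt_min hε₀ one_pos
  have hκ1 : κ ≤ 1 := min_le_right _ _
  have hκε : κ ≤ ε₀ := min_le_left _ _
  -- With `e = κ ≤ 1`, the requirement `2 * L + 2 * κ + e ≤ η * c` holds for this `c`.
  set c := (2 * L + 3) / η with hc
  have hc0 : 0 < c := by positivity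
  have hηc : η * c = 2 * L + 3 := by rw [hc]; field_simp
  have hlim : Tendsto (fun n => c * ε / r n) atTop (𝓝[>] 0) := by
    refine tendsto_nhdsWithin_iff.2 ⟨tendsto_const_nhds.div_atTop hr, ?_⟩
    filter_upwards [hr.eventually_gt_atTop 0] with n hn
    exact div_pos (mul_pos hc0 hε) hn
  filter_upwards [hr.eventually_ge_atTop c, hlim.eventually hC,
    eventually_mul_abs_le hr hfv C (mul_pos hc0 hε) hκ0,
    (tendsto_nhds_of_tendsto_nhdsWithin hlim).eventually_lt_const hκ'] with n hcn hCn hfn hκn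
  have hR : 0 < r n := hc0.trans_le hcn
  have hrad : c / r n * ε = c * ε / r n := by ring
  filter_upwards [ae_forall_quasiconcaveOn (w := fun ω t => vn n ω θ t) hΘ hT hDc θ (hqc n),
    hvusc n θ hθ.1] with ω hω hωu hGL hGm
  obtain ⟨t, ht, hst⟩ := exists_almostActive_ge (w := vn n ω) (g := Gn n ω) (R := r n) (c := c)
    (e := κ) (κ := κ) (m := ε₀) (L := L) (η := η) hseg hv hl hθ hε hconv hDc hDconv hDhom hDusc
    (hGn n ω) hGL hω
    (by
      convert hωu using 2 with t
      rw [sub_self, (hDhom t t.2).map_zero, add_zero])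
    hR hc0 hcn
    (fun θ' hθ' t ht h => by
      rw [hrad] at h
      exact (mul_le_mul_of_nonneg_left (hCn θ hθ θ' hθ' t ht h) hR.le).trans hfn)
    (fun θ' h t => by
      rw [hrad] at h
      exact hGm _ _ (hmod ⟨θ, hθ.1⟩ θ' (h.trans_lt hκn) t))
    hκ0 (by linarith) (by nlinarith)
  -- Moving from `t` to `s` costs one `ε₀`; the errors `2 * κ + e + m` cost at most four.
  obtain ⟨s, hs, hρs⟩ := hηU ht
  refine ⟨s, hs, ?_⟩
  have := (abs_le.1 (hGm _ _ hρs)).2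
  unfold stat
  linarith

variable [∀ n, IsProbabilityMeasure (P n)]

theorem upper_bound_at (hΘ : IsCompact Θ) (hT : Convex ℝ T)
    (hseg : SegmentsContinuous T)
    (hv : ∀ θ ∈ Θ, BddAbove (range fun t : T => v θ t)) (hl : ∀ θ ∈ Θ, 0 ≤ criterion T v θ)
    (hr : Tendsto r atTop atTop)
    (hGn : ∀ (n : ℕ) (ω : Ω n) (x : Θ × T), Gn n ω x = r n * (vn n ω x.1 x.2 - v x.1 x.2))
    (hGb : ∀ η : ENNReal, 0 < η → ∃ L : ℝ, 0 < L ∧ ∀ᶠ n in atTop, P n {ω | L < ‖Gn n ω‖} ≤ η)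
    (hGe : AsympEquicont P Gn ρ)
    (hρ : ∀ x : Θ × T, Tendsto (fun y => ρ y x) (𝓝 x) (𝓝 0))
    (hfv : fv =o[𝓝[>] 0] (fun δ : ℝ => δ))
    (happrox : ∃ C : ℝ, ∀ᶠ δ in 𝓝[>] (0 : ℝ), ∀ θ ∈ identifiedSet Θ T v, ∀ θ' ∈ Θ, ∀ t ∈ T,
      ‖θ' - θ‖ ≤ δ → |v θ' t - v θ t - D θ t (θ' - θ)| ≤ C * |fv δ|)
    {θ : 𝔅} (hθ : θ ∈ identifiedSet Θ T v) {ε : ℝ} (hε : 0 < ε)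
    (hconv : Convex ℝ (Θ ∩ Metric.ball θ ε))
    (hDc : ∀ t ∈ T, Continuous (D θ t)) (hDconv : ∀ t ∈ T, ConvexOn ℝ univ (D θ t))
    (hDhom : ∀ t ∈ T, PosHomogeneous (D θ t))
    (hDusc : ∀ θ' ∈ Θ, UpperSemicontinuous fun t : T => D θ t (θ' - θ))
    (hqc : ∀ n : ℕ, ∀ θ' ∈ Θ, ∀ᵐ ω ∂(P n),
      QuasiconcaveOn ℝ T (fun t => vn n ω θ t + D θ t (θ' - θ)))
    (hvusc : ∀ n : ℕ, ∀ θ' ∈ Θ, ∀ᵐ ω ∂(P n),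
      UpperSemicontinuous (fun t : T => vn n ω θ t + D θ t (θ' - θ)))
    {A : Set T}
    (hA : ∀ U : Set T, (∀ t ∈ A, U ∈ 𝓝 t) → ∃ η > 0, almostActive Θ T v D θ ε η ⊆ U) :
    A.Nonempty ∧ ∀ ε₀ > 0, Tendsto (fun n => P n {ω |
      (⨆ t : A, Gn n ω (⟨θ, hθ.1⟩, t)) + ε₀ < stat Θ T r vn n ω}) atTop (𝓝 0) := by
  have key : ∀ ε₀ > 0, ∀ η : ENNReal, 0 < η → ∃ B : ∀ n, Set (Ω n),
      (∀ᶠ n in atTop, P n (B n) ≤ η) ∧ ∀ᶠ n in atTop, ∀ᵐ ω ∂(P n), ω ∉ B n →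
      ∃ t ∈ A, stat Θ T r vn n ω ≤ Gn n ω (⟨θ, hθ.1⟩, t) + 5 * ε₀ := by
    intro ε₀ hε₀ η hη
    obtain ⟨L, δ, hL, hδ, B, hB, hBc⟩ := hGe.exists_compl hGb hε₀ hη
    refine ⟨B, hB, (eventually_exists_stat_le hΘ hT hseg hv hl hr hGn hρ hfv happrox hθ hε hconv
      hDc hDconv hDhom hDusc hqc hvusc hA hL hδ hε₀).mono fun n hn => hn.mono fun ω hω hωB => ?_⟩
    exact hω (hBc n ω hωB).1 (hBc n ω hωB).2
  refine ⟨?_, fun ε₀ hε₀ => tendsto_measure_zero_of_forall fun η hη => ?_⟩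
  -- Nonemptiness of the deterministic set `A`: the exceptional set has outer probability at most `1
  -- / 2`, so some outcome outside it supplies an index.
  · obtain ⟨B, hB, hBc⟩ := key 1 one_pos (1 / 2) (by simp)
    obtain ⟨n, h1, h2⟩ := (hB.and hBc).exists
    have : ∃ᵐ ω ∂(P n), ω ∉ B n := by
      intro h
      simp only [not_not] at h
      have h3 : P n (B n) = 1 := by
        have h0 : B n ∈ ae (P n) := h
        rw [measure_congr (eventuallyEq_univ.2 h0), measure_univ]
      rw [h3] at h1
      norm_num at h1
    obtain ⟨ω, hω, h⟩ := (this.and_eventually h2).exists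
    obtain ⟨t, ht, -⟩ := h hω
    exact ⟨t, ht⟩
  · obtain ⟨B, hB, hBc⟩ := key (ε₀ / 5) (by positivity) η hη
    refine ⟨B, hB, tendsto_const_nhds.congr' ?_⟩
    filter_upwards [hBc] with n hn
    symm
    refine measure_mono_null (fun ω hω => ?_) (ae_iff.1 hn)
    rw [mem_ofPred_eq]
    intro hcon
    obtain ⟨t, ht, hst⟩ := hcon hω.2
    have h1 := le_ciSup (f := fun t : A => Gn n ω (⟨θ, hθ.1⟩, (t : T)))
      (bddAbove_range_apply (Gn n ω) fun t : A => (⟨θ, hθ.1⟩, (t : T))) ⟨t, ht⟩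
    have h2 := hω.1
    simp only [mem_ofPred_eq] at h1 h2
    linarith

end Upper

/-- An upper bound for each `θ` is uniform over `θ` by asymptotic equicontinuity. -/
theorem tendsto_infSup_add_lt_stat {𝔅 E : Type*} [NormedAddCommGroup 𝔅] {Θ : Set 𝔅} {T : Set E}
    [TopologicalSpace T] [CompactSpace T] {r : ℕ → ℝ} {Ω : ℕ → Type*} [∀ n, MeasurableSpace (Ω n)]
    {P : ∀ n, Measure (Ω n)} {vn : ∀ n, Ω n → 𝔅 → E → ℝ} {Gn : ∀ n, Ω n → LInf Θ T}
    {ρ : PseudoMetric (Θ × T) ℝ} (hΘ : IsCompact Θ) (hGe : AsympEquicont P Gn ρ)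
    (hρ : ∀ x : Θ × T, Tendsto (fun y => ρ y x) (𝓝 x) (𝓝 0)) {Θ₀ : Set 𝔅}
    (hΘ₀ : ∃ θ ∈ Θ₀, θ ∈ Θ) {A : 𝔅 → Set T} (hA : ∀ θ ∈ Θ₀, θ ∈ Θ → (A θ).Nonempty)
    (hup : ∀ θ : Θ, (θ : 𝔅) ∈ Θ₀ → ∀ ε₀ > 0, Tendsto (fun n => P n {ω |
      (⨆ t : A θ, Gn n ω (θ, t)) + ε₀ < stat Θ T r vn n ω}) atTop (𝓝 0)) {ε : ℝ} (hε : 0 < ε) :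
    Tendsto (fun n => P n {ω | infSup Θ₀ A (Gn n ω) + ε < stat Θ T r vn n ω}) atTop (𝓝 0) := by
  have := isCompact_iff_compactSpace.1 hΘ
  refine tendsto_measure_zero_of_forall fun η hη => ?_
  obtain ⟨δ, hδ, hB⟩ := hGe.exists_eventually_le (half_pos hε) hη
  refine ⟨_, hB, ?_⟩
  -- One-sided approximation is enough: if every point of the slice at `j` is near the slice at `θ`,
  -- the supremum at `j` exceeds that at `θ` by at most `ε / 2`.
  obtain ⟨F, hF, hFa⟩ := exists_finite_approx hρ
    (fun θ : {θ : Θ // (θ : 𝔅) ∈ Θ₀} => (fun t => ((θ : Θ), t)) '' A (θ : Θ)) hδ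
  have hsum : Tendsto (fun n => ∑ θ ∈ hF.toFinset, P n {ω |
      (⨆ t : A (θ : Θ), Gn n ω (θ, t)) + ε / 2 < stat Θ T r vn n ω}) atTop (𝓝 0) := by
    simpa using tendsto_finsetSum hF.toFinset fun θ _ => hup θ θ.2 (ε / 2) (half_pos hε)
  refine tendsto_of_tendsto_of_tendsto_of_le_of_le tendsto_const_nhds hsum (fun _ => zero_le)
    fun n => (measure_mono fun ω hω => ?_).trans (measure_biUnion_finset_le _ _)
  obtain ⟨hω, hωB⟩ := hω
  simp only [mem_ofPred_eq, not_exists, not_and, not_lt] at hω hωB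
  by_contra hcon
  simp only [mem_iUnion, Set.Finite.mem_toFinset, mem_ofPred_eq, exists_prop, not_exists, not_and,
    not_lt] at hcon
  refine absurd hω (not_lt.2 ?_)
  rw [← sub_le_iff_le_add]
  refine le_infSup hΘ₀ fun θ hθ => ?_
  obtain ⟨j, hj, hjθ⟩ := hFa ⟨θ, hθ⟩
  have h1 := hcon j hj
  have : Nonempty (A (j : Θ)) := (hA j j.2 j.1.2).to_subtype
  have h2 : (⨆ t : A (j : Θ), Gn n ω (j, t)) ≤ (⨆ t : A θ, Gn n ω (θ, t)) + ε / 2 := by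
    refine ciSup_le fun t => ?_
    obtain ⟨_, ⟨s, hs, rfl⟩, hsρ⟩ := hjθ _ ⟨t, t.2, rfl⟩
    have h3 := (abs_le.1 (hωB _ _ hsρ)).2
    have h4 := le_ciSup (f := fun t : A θ => Gn n ω (θ, (t : T)))
      (bddAbove_range_apply (Gn n ω) fun t : A θ => (θ, (t : T))) ⟨s, hs⟩
    simp only at h3 h4
    linarith
  linarith

/-! ### The identified set and the lower bounds -/

section Lower

theorem exists_uniform_radius {𝔅 : Type*} [PseudoMetricSpace 𝔅] {S : Set 𝔅} (hS : IsCompact S)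
    {p : Set 𝔅 → Prop} (hp : ∀ θ ε θ' ε', Metric.ball θ' ε' ⊆ Metric.ball θ ε →
      p (Metric.ball θ ε) → p (Metric.ball θ' ε'))
    (h : ∀ θ ∈ S, ∃ ε : ℝ, 0 < ε ∧ p (Metric.ball θ ε)) :
    ∃ ε : ℝ, 0 < ε ∧ ∀ θ ∈ S, p (Metric.ball θ ε) := by
  choose! e he hpe using h
  obtain ⟨δ, hδ, hcov⟩ := lebesgue_number_lemma_of_metric
    (c := fun θ : S => Metric.ball (θ : 𝔅) (e θ)) hS (fun _ => Metric.isOpen_ball)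
    (fun θ hθ => mem_iUnion.2 ⟨⟨θ, hθ⟩, Metric.mem_ball_self (he θ hθ)⟩)
  -- A Lebesgue number of the cover by the given balls serves as the common radius.
  refine ⟨δ, hδ, fun θ hθ => ?_⟩
  obtain ⟨i, hi⟩ := hcov θ hθ
  exact hp i (e i) θ δ hi (hpe i i.2)

variable {𝔅 E : Type*} [NormedAddCommGroup 𝔅] {Θ : Set 𝔅} {T : Set E} {v : 𝔅 → E → ℝ}

theorem isCompact_identifiedSet (hΘ : IsCompact Θ) (hl : ∀ θ ∈ Θ, 0 ≤ criterion T v θ)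
    (hlsc : LowerSemicontinuousOn (criterion T v) Θ) : IsCompact (identifiedSet Θ T v) := by
  obtain ⟨S, hS, hSe⟩ := lowerSemicontinuousOn_iff_preimage_Iic.1 hlsc 0
  have : identifiedSet Θ T v = Θ ∩ S := by
    rw [← hSe]
    ext θ
    exact and_congr_right fun hθ => ⟨fun h => h.le, fun h => le_antisymm h (hl θ hθ)⟩
  rw [this]
  exact hΘ.inter_right hS

theorem exists_pos_le_criterion (hl : ∀ θ ∈ Θ, 0 ≤ criterion T v θ)
    (hlsc : LowerSemicontinuousOn (criterion T v) Θ) {S : Set 𝔅} (hS : IsCompact S) (hSΘ : S ⊆ Θ)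
    (hdisj : ∀ θ ∈ S, θ ∉ identifiedSet Θ T v) : ∃ m : ℝ, 0 < m ∧ ∀ θ ∈ S, m ≤ criterion T v θ := by
  rcases S.eq_empty_or_nonempty with rfl | hne
  · exact ⟨1, one_pos, by simp⟩
  · obtain ⟨a, ha, hmin⟩ := (hlsc.mono hSΘ).exists_isMinOn hne hS
    exact ⟨_, (hl a (hSΘ ha)).lt_of_ne fun h => hdisj a ha ⟨hSΘ ha, h.symm⟩, fun θ hθ => hmin hθ⟩

variable {r : ℕ → ℝ} {Ω : ℕ → Type*} [∀ n, MeasurableSpace (Ω n)] {P : ∀ n, Measure (Ω n)}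
  {vn : ∀ n, Ω n → 𝔅 → E → ℝ} {Gn : ∀ n, Ω n → LInf Θ T} [Nonempty T]

theorem isBigOP_stat_of_empty (hΘ_ne : Θ.Nonempty) (hΘ : IsCompact Θ)
    (hv : ∀ θ ∈ Θ, BddAbove (range fun t : T => v θ t)) (hl : ∀ θ ∈ Θ, 0 ≤ criterion T v θ)
    (hlsc : LowerSemicontinuousOn (criterion T v) Θ) (hr : Tendsto r atTop atTop)
    (hGn : ∀ (n : ℕ) (ω : Ω n) (x : Θ × T), Gn n ω x = r n * (vn n ω x.1 x.2 - v x.1 x.2))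
    (hGb : ∀ η : ENNReal, 0 < η → ∃ L : ℝ, 0 < L ∧ ∀ᶠ n in atTop, P n {ω | L < ‖Gn n ω‖} ≤ η)
    (hΘ₀ : identifiedSet Θ T v = ∅) : IsBigOP P (fun n _ => r n) (stat Θ T r vn) := by
  obtain ⟨m, hm, hml⟩ := exists_pos_le_criterion hl hlsc hΘ subset_rfl (by simp [hΘ₀])
  intro η hη
  obtain ⟨L, hL, hGL⟩ := hGb η hη
  refine ⟨2 / m, ?_⟩
  filter_upwards [hGL, hr.eventually_gt_atTop 0, hr.eventually_ge_atTop (2 * L / m)]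
    with n hn hR hRL
  refine (measure_mono fun ω hω => ?_).trans hn
  simp only [mem_ofPred_eq] at hω ⊢
  by_contra! hcon
  refine absurd hω (not_lt.2 ?_)
  have : Nonempty Θ := hΘ_ne.to_subtype
  have h1 : (r n * m - L) / r n ≤ ⨅ θ : Θ, ⨆ t : T, vn n ω θ t := by
    refine le_ciInf fun θ => ?_
    rw [div_le_iff₀ hR, mul_comm (⨆ t : T, vn n ω θ t)]
    have h2 := mul_criterion_sub_norm_le hR (hGn n ω) hv θ
    have h3 := mul_le_mul_of_nonneg_left (hml θ θ.2) hR.le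
    linarith
  rw [div_le_iff₀ hR, mul_comm (⨅ θ : Θ, ⨆ t : T, vn n ω θ t)] at h1
  rw [div_le_iff₀ hm] at hRL
  have h4 : r n * m / 2 ≤ |stat Θ T r vn n ω| :=
    (by linarith : _ ≤ _).trans (h1.trans (le_abs_self _))
  rw [abs_of_pos hR]
  calc r n = 2 / m * (r n * m / 2) := by field_simp
    _ ≤ _ := by gcongr

/-- The lower bound, given near minimizers at which `v` is asymptotically not negative on the active
indices of nearest points of the identified set. -/
theorem tendsto_stat_add_lt_infSup [TopologicalSpace T] [CompactSpace T]
    {ρ : PseudoMetric (Θ × T) ℝ} (hΘ : IsCompact Θ)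
    (hv : ∀ θ ∈ Θ, BddAbove (range fun t : T => v θ t)) (hl : ∀ θ ∈ Θ, 0 ≤ criterion T v θ)
    (hlsc : LowerSemicontinuousOn (criterion T v) Θ) (hr : Tendsto r atTop atTop)
    (hGn : ∀ (n : ℕ) (ω : Ω n) (x : Θ × T), Gn n ω x = r n * (vn n ω x.1 x.2 - v x.1 x.2))
    (hGb : ∀ η : ENNReal, 0 < η → ∃ L : ℝ, 0 < L ∧ ∀ᶠ n in atTop, P n {ω | L < ‖Gn n ω‖} ≤ η)
    (hGe : AsympEquicont P Gn ρ)
    (hρ : ∀ x : Θ × T, Tendsto (fun y => ρ y x) (𝓝 x) (𝓝 0))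
    (hΘ₀ : (identifiedSet Θ T v).Nonempty) {A : 𝔅 → Set T}
    (hA : ∀ θ ∈ identifiedSet Θ T v, (A θ).Nonempty)
    {θhat : ∀ n, Ω n → 𝔅} (hθhat : ∀ n ω, θhat n ω ∈ Θ)
    (hmin : ∀ ε : ℝ, 0 < ε → Tendsto (fun n => P n {ω |
      (⨅ θ : Θ, ⨆ t : T, vn n ω θ t) + ε * |(r n)⁻¹| < ⨆ t : T, vn n ω (θhat n ω) t}) atTop (𝓝 0))
    {κ₀ : ℝ} (hκ₀ : 0 < κ₀)
    (hneg : ∀ ε : ℝ, 0 < ε → Tendsto (fun n => P n {ω | ∃ θ ∈ identifiedSet Θ T v,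
      Metric.infDist (θhat n ω) (identifiedSet Θ T v) = ‖θhat n ω - θ‖ ∧ ‖θhat n ω - θ‖ < κ₀ ∧
      ∃ t ∈ A θ, r n * v (θhat n ω) t < -ε}) atTop (𝓝 0)) {ε : ℝ} (hε : 0 < ε) :
    Tendsto (fun n => P n {ω | stat Θ T r vn n ω + ε <
      infSup (identifiedSet Θ T v) A (Gn n ω)}) atTop (𝓝 0) := by
  refine tendsto_measure_zero_of_forall fun η hη => ?_
  have hε4 : 0 < ε / 4 := by positivity
  obtain ⟨L, δ, hL, hδ, B, hB, hBc⟩ := hGe.exists_compl hGb hε4 hη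
  refine ⟨B, hB, ?_⟩
  obtain ⟨κ', hκ', hmod⟩ := exists_uniform_pseudoMetric_lt hΘ hρ hδ
  have hcomp := isCompact_identifiedSet hΘ hl hlsc
  have hκ1 : 0 < min κ' κ₀ := lt_min hκ' hκ₀
  -- If the near minimizer were this far from `Θ₀`, then `r n * m ≤ 2 * L + ε / 4`, which fails for
  -- large `n`.
  obtain ⟨m, hm, hml⟩ := exists_pos_le_criterion (v := v) (T := T) hl hlsc
    (S := Θ ∩ {θ | min κ' κ₀ ≤ Metric.infDist θ (identifiedSet Θ T v)})
    (hΘ.inter_right (isClosed_le continuous_const (Metric.continuous_infDist_pt _)))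
    inter_subset_left (fun θ hθ h => by
      have := hθ.2
      rw [mem_ofPred_eq, Metric.infDist_zero_of_mem h] at this
      linarith)
  refine tendsto_measure_zero_of_subset (tendsto_measure_zero_union (hmin _ hε4) (hneg _ hε4)) ?_
  filter_upwards [hr.eventually_gt_atTop 0, hr.eventually_gt_atTop ((2 * L + ε / 4) / m)]
    with n hR hRm
  rintro ω ⟨hω, hωB⟩
  by_contra hcon
  simp only [mem_union, mem_ofPred_eq, not_or, not_lt, not_exists, not_and] at hω hcon
  obtain ⟨h1, h2⟩ := hcon
  obtain ⟨hGL, hGm⟩ := hBc n ω hωB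
  rw [div_lt_iff₀ hm] at hRm
  set θh : Θ := ⟨θhat n ω, hθhat n ω⟩ with hθh
  have hbb := bddBelow_perturbed hR (hGn n ω) hv hl
  have h3 : r n * (⨆ t : T, vn n ω (θhat n ω) t) ≤ stat Θ T r vn n ω + ε / 4 := by
    have := mul_le_mul_of_nonneg_left h1 hR.le
    rw [mul_add, abs_of_pos (inv_pos.2 hR), mul_left_comm, mul_inv_cancel₀ hR.ne', mul_one] at this
    exact this
  have h4 : stat Θ T r vn n ω ≤ L := by
    obtain ⟨θ₀, hθ₀⟩ := hΘ₀
    have h5 : ⨅ θ : Θ, ⨆ t : T, vn n ω θ t ≤ L / r n := by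
      refine (ciInf_le hbb ⟨θ₀, hθ₀.1⟩).trans (ciSup_le fun t => ?_)
      rw [le_div_iff₀ hR, mul_comm]
      have h6 := mul_eq_add (hGn n ω) (⟨θ₀, hθ₀.1⟩, t)
      have h7 := (abs_le.1 (abs_apply_le_norm (Gn n ω) (⟨θ₀, hθ₀.1⟩, t))).2
      have h8 : r n * v θ₀ t ≤ 0 :=
        mul_nonpos_of_nonneg_of_nonpos hR.le (le_zero_of_mem_identifiedSet hv hθ₀ t.2)
      simp only at h6
      linarith
    rw [le_div_iff₀ hR, mul_comm] at h5
    exact h5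
  have h9 : Metric.infDist (θhat n ω) (identifiedSet Θ T v) < min κ' κ₀ := by
    by_contra! hfar
    have h10 := mul_le_mul_of_nonneg_left (hml _ ⟨hθhat n ω, hfar⟩) hR.le
    have h11 := mul_criterion_sub_norm_le hR (hGn n ω) hv θh
    simp only [hθh] at h11
    linarith
  obtain ⟨θ, hθ, hd⟩ := hcomp.exists_infDist_eq_dist hΘ₀ (θhat n ω)
  rw [dist_eq_norm] at hd
  rw [hd] at h9
  have : Nonempty (A θ) := (hA θ hθ).to_subtype
  -- Three errors of `ε / 4`: near minimality, the sign of `v`, and equicontinuity.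
  have h12 : (⨆ t : A θ, Gn n ω (⟨θ, hθ.1⟩, t)) ≤ stat Θ T r vn n ω + ε := by
    refine ciSup_le fun t => ?_
    have h13 := h2 θ hθ hd (h9.trans_le (min_le_right _ _)) t t.2
    have h14 := (abs_le.1 (hGm _ _ (hmod ⟨θ, hθ.1⟩ θh (h9.trans_le (min_le_left _ _)) t))).1
    have h15 := mul_eq_add (hGn n ω) (θh, t)
    have h16 := mul_le_mul_of_nonneg_left
      (le_ciSup (f := fun t : T => vn n ω (θhat n ω) t)
        (bddAbove_perturbed hR (hGn n ω) hv θh) t) hR.le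
    simp only [hθh] at h14 h15 h16
    linarith
  have h17 := infSup_le (fun θ hθ _ => hA θ hθ) (Gn n ω) ⟨θ, hθ.1⟩ hθ
  simp only at h17
  linarith

end Lower

/-! ### Asymptotic nonnegativity of `v` at near minimizers. -/

section Nonneg

variable {𝔅 E : Type*} [NormedAddCommGroup 𝔅] [NormedSpace ℝ 𝔅] {Θ : Set 𝔅} {T : Set E}
  {v : 𝔅 → E → ℝ} {D : 𝔅 → E → 𝔅 → ℝ} {fv : ℝ → ℝ}

/-- A function that is convex near `θ` and vanishes at `θ`, with nonnegative directional derivative,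
is nonnegative near `θ`. -/
theorem nonneg_of_convexOn {C ε : ℝ} {θ θ' : 𝔅} {t : E}
    (hfv : fv =o[𝓝[>] 0] (fun δ : ℝ => δ))
    (happrox : ∀ᶠ δ in 𝓝[>] (0 : ℝ), ∀ θ' ∈ Θ,
      ‖θ' - θ‖ ≤ δ → |v θ' t - v θ t - D θ t (θ' - θ)| ≤ C * |fv δ|)
    (hε : 0 < ε) (hθ : θ ∈ Θ) (hv0 : v θ t = 0)
    (hD : ∀ θ' ∈ Θ ∩ Metric.ball θ ε, 0 ≤ D θ t (θ' - θ))
    (hconv : ConvexOn ℝ (Θ ∩ Metric.ball θ ε) fun θ' => v θ' t)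
    (hθ' : θ' ∈ Θ ∩ Metric.ball θ ε) : 0 ≤ v θ' t := by
  rcases eq_or_ne θ' θ with rfl | hne
  · exact hv0.ge
  have ha : 0 < ‖θ' - θ‖ := norm_pos_iff.2 (sub_ne_zero.2 hne)
  refine le_of_forall_pos_le_add fun κ hκ => ?_
  have hlim : Tendsto (fun n : ℕ => ‖θ' - θ‖ / (n : ℝ)) atTop (𝓝[>] 0) := by
    refine tendsto_nhdsWithin_iff.2
      ⟨tendsto_const_nhds.div_atTop tendsto_natCast_atTop_atTop, ?_⟩
    filter_upwards [eventually_gt_atTop 0] with n hn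
    exact div_pos ha (by exact_mod_cast hn)
  -- At the fraction `1 / n` of the way to `θ'`, convexity bounds `v` above by `v θ' t / n`, and the
  -- approximation bounds it below by `-o(1 / n)`.
  obtain ⟨n, h1, h2, hn⟩ := ((hlim.eventually happrox).and
    ((eventually_mul_abs_le tendsto_natCast_atTop_atTop hfv C ha hκ).and
      (eventually_ge_atTop 1))).exists
  have hn1 : (1 : ℝ) ≤ n := by exact_mod_cast hn
  have hs0 : 0 ≤ (n : ℝ)⁻¹ := by positivity
  have hs1 : (n : ℝ)⁻¹ ≤ 1 := inv_le_one_of_one_le₀ hn1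
  have hmem := add_smul_mem_inter_ball hε hθ hconv.1 (h := θ' - θ) (by simpa using hθ') hs0 hs1
  have h3 := h1 _ hmem.1 (by
    rw [add_sub_cancel_left, norm_smul, Real.norm_of_nonneg hs0, div_eq_inv_mul])
  have h4 := hD _ hmem
  have h5 := hconv.2 ⟨hθ, Metric.mem_ball_self hε⟩ hθ' (sub_nonneg.2 hs1) hs0 (by ring)
  have h6 : (1 - (n : ℝ)⁻¹) • θ + (n : ℝ)⁻¹ • θ' = θ + (n : ℝ)⁻¹ • (θ' - θ) := by module
  rw [h6] at h5
  simp only [smul_eq_mul, hv0, mul_zero, zero_add] at h5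
  rw [hv0] at h3
  have h7 := (abs_le.1 h3).1
  have h8 : -(C * |fv (‖θ' - θ‖ / n)|) ≤ (n : ℝ)⁻¹ * v θ' t := by linarith
  have h9 := mul_le_mul_of_nonneg_left h8 (by positivity : (0 : ℝ) ≤ n)
  rw [mul_inv_cancel_left₀ (by positivity)] at h9
  linarith

end Nonneg

section Rates

variable {𝔅 E : Type*} [NormedAddCommGroup 𝔅] [NormedSpace ℝ 𝔅] {Θ : Set 𝔅} {T : Set E}
  {v : 𝔅 → E → ℝ} {D : 𝔅 → E → 𝔅 → ℝ} {fv : ℝ → ℝ} {r : ℕ → ℝ}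
  {Ω : ℕ → Type*} [∀ n, MeasurableSpace (Ω n)] {P : ∀ n, Measure (Ω n)}

/-- At an active index `v` vanishes at the nearest point and `D` is nonnegative, so a negative `v`
is only approximation error, of order `fv` of the distance to `Θ₀`. -/
theorem exists_tendsto_neg_of_isLittleOP (hr : Tendsto r atTop atTop) {ε₀ : ℝ} (hε₀ : 0 < ε₀)
    (hconv : ∀ θ ∈ identifiedSet Θ T v, Convex ℝ (Θ ∩ Metric.ball θ ε₀))
    (hDhom : ∀ θ ∈ identifiedSet Θ T v, ∀ t ∈ T, PosHomogeneous (D θ t))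
    (happrox : ∃ C : ℝ, ∀ᶠ δ in 𝓝[>] (0 : ℝ), ∀ θ ∈ identifiedSet Θ T v, ∀ θ' ∈ Θ, ∀ t ∈ T,
      ‖θ' - θ‖ ≤ δ → |v θ' t - v θ t - D θ t (θ' - θ)| ≤ C * |fv δ|)
    {θhat : ∀ n, Ω n → 𝔅} (hθhat : ∀ n ω, θhat n ω ∈ Θ)
    (hrate : IsLittleOP P (fun n ω => fv (Metric.infDist (θhat n ω) (identifiedSet Θ T v)))
      (fun n => (r n)⁻¹)) :
    ∃ κ₀ : ℝ, 0 < κ₀ ∧ ∀ ε : ℝ, 0 < ε → Tendsto (fun n => P n {ω | ∃ θ ∈ identifiedSet Θ T v,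
      Metric.infDist (θhat n ω) (identifiedSet Θ T v) = ‖θhat n ω - θ‖ ∧ ‖θhat n ω - θ‖ < κ₀ ∧
      ∃ t ∈ Ktilde Θ T v D θ, r n * v (θhat n ω) t < -ε}) atTop (𝓝 0) := by
  obtain ⟨C, hC⟩ := happrox
  obtain ⟨δ₀, hδ₀, hCδ⟩ := mem_nhdsGT_iff_exists_Ioo_subset.1 hC
  rw [mem_Ioi] at hδ₀
  refine ⟨min ε₀ δ₀, lt_min hε₀ hδ₀, fun ε hε => ?_⟩
  have hpos : 0 < ε / (|C| + 1) := by positivity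
  refine tendsto_measure_zero_of_subset (hrate _ hpos) ?_
  filter_upwards [hr.eventually_gt_atTop 0] with n hR
  rintro ω ⟨θ, hθ, hd, hlt, t, ⟨hγ, hv0⟩, hneg⟩
  rw [mem_ofPred_eq, hd, abs_of_pos (inv_pos.2 hR)]
  -- The approximation is available only for positive radii, so distance zero is treated separately.
  rcases eq_or_ne (θhat n ω) θ with heq | hne
  · rw [heq, hv0, mul_zero] at hneg
    linarith
  have hpos' : 0 < ‖θhat n ω - θ‖ := norm_pos_iff.2 (sub_ne_zero.2 hne)
  have h1 := hCδ ⟨hpos', hlt.trans_le (min_le_right _ _)⟩ θ hθ _ (hθhat n ω) t t.2 le_rfl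
  have h2 := (gamma_eq_zero_iff hε₀ hθ.1 (hconv θ hθ) (hDhom θ hθ t t.2)).1 hγ _
    ⟨hθhat n ω, by rw [mem_ball_iff_norm]; exact hlt.trans_le (min_le_left _ _)⟩
  rw [hv0] at h1
  have h3 := (abs_le.1 h1).1
  have h4 : -((|C| + 1) * |fv ‖θhat n ω - θ‖|) ≤ v (θhat n ω) t := by
    have := mul_le_mul_of_nonneg_right (le_abs_self C) (abs_nonneg (fv ‖θhat n ω - θ‖))
    linarith [abs_nonneg (fv ‖θhat n ω - θ‖)]
  have h5 := mul_le_mul_of_nonneg_left h4 hR.le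
  rw [div_mul_eq_mul_div, div_lt_iff₀ (by positivity), mul_inv_lt_iff₀ hR]
  linarith

theorem exists_tendsto_neg_of_convexOn (hfv : fv =o[𝓝[>] 0] (fun δ : ℝ => δ))
    (hr : Tendsto r atTop atTop) {ε₀ : ℝ} (hε₀ : 0 < ε₀)
    (hconv : ∀ θ ∈ identifiedSet Θ T v, ∀ t ∈ T,
      ConvexOn ℝ (Θ ∩ Metric.ball θ ε₀) fun θ' => v θ' t)
    (hDhom : ∀ θ ∈ identifiedSet Θ T v, ∀ t ∈ T, PosHomogeneous (D θ t))
    (happrox : ∃ C : ℝ, ∀ᶠ δ in 𝓝[>] (0 : ℝ), ∀ θ ∈ identifiedSet Θ T v, ∀ θ' ∈ Θ, ∀ t ∈ T,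
      ‖θ' - θ‖ ≤ δ → |v θ' t - v θ t - D θ t (θ' - θ)| ≤ C * |fv δ|)
    {θhat : ∀ n, Ω n → 𝔅} (hθhat : ∀ n ω, θhat n ω ∈ Θ) (ε : ℝ) (hε : 0 < ε) :
    Tendsto (fun n => P n {ω | ∃ θ ∈ identifiedSet Θ T v,
      Metric.infDist (θhat n ω) (identifiedSet Θ T v) = ‖θhat n ω - θ‖ ∧ ‖θhat n ω - θ‖ < ε₀ ∧
      ∃ t ∈ Ktilde Θ T v D θ, r n * v (θhat n ω) t < -ε}) atTop (𝓝 0) := by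
  obtain ⟨C, hC⟩ := happrox
  refine tendsto_measure_zero_of_subset (B := fun _ => ∅) (by simp) ?_
  filter_upwards [hr.eventually_gt_atTop 0] with n hR
  rintro ω ⟨θ, hθ, -, hlt, t, ⟨hγ, hv0⟩, hneg⟩
  have h1 := nonneg_of_convexOn (D := D) hfv
    (hC.mono fun δ h θ' hθ' => h θ hθ θ' hθ' t t.2) hε₀ hθ.1 hv0
    ((gamma_eq_zero_iff hε₀ hθ.1 (hconv θ hθ t t.2).1 (hDhom θ hθ t t.2)).1 hγ) (hconv θ hθ t t.2)
    (θ' := θhat n ω) ⟨hθhat n ω, by rwa [mem_ball_iff_norm]⟩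
  have h2 := mul_nonneg hR.le h1
  exact absurd hneg (by linarith)

end Rates

/-- Near minimizers of a random criterion, up to `o(1 / r n)`. -/
theorem exists_near_minimizer {𝔅 E : Type*} {Θ : Set 𝔅} {T : Set E} {Ω : ℕ → Type*}
    [∀ n, MeasurableSpace (Ω n)] (P : ∀ n, Measure (Ω n)) (hΘ : Θ.Nonempty) {r : ℕ → ℝ}
    (hr : Tendsto r atTop atTop) (vn : ∀ n, Ω n → 𝔅 → E → ℝ) :
    ∃ θhat : ∀ n, Ω n → 𝔅, (∀ n ω, θhat n ω ∈ Θ) ∧ ∀ ε : ℝ, 0 < ε → Tendsto (fun n => P n {ω |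
      (⨅ θ : Θ, ⨆ t : T, vn n ω θ t) + ε * |(r n)⁻¹| < ⨆ t : T, vn n ω (θhat n ω) t})
      atTop (𝓝 0) := by
  have hne : Nonempty Θ := hΘ.to_subtype
  have hex : ∀ n ω, ∃ θ : Θ, 0 < r n → ⨆ t : T, vn n ω θ t <
      (⨅ θ : Θ, ⨆ t : T, vn n ω θ t) + 1 / ((n : ℝ) + 1) * (r n)⁻¹ := by
    intro n ω
    by_cases hR : 0 < r n
    · obtain ⟨θ, hθ⟩ := exists_lt_of_ciInf_lt (lt_add_of_pos_right (⨅ θ : Θ, ⨆ t : T, vn n ω θ t)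
        (show 0 < 1 / ((n : ℝ) + 1) * (r n)⁻¹ by positivity))
      exact ⟨θ, fun _ => hθ⟩
    · exact ⟨hne.some, fun h => absurd h hR⟩
  choose θhat hθhat using hex
  refine ⟨fun n ω => θhat n ω, fun n ω => (θhat n ω).2, fun ε hε => ?_⟩
  refine tendsto_measure_zero_of_subset (B := fun _ => ∅) (by simp) ?_
  filter_upwards [hr.eventually_gt_atTop 0,
    (tendsto_one_div_add_atTop_nhds_zero_nat (𝕜 := ℝ)).eventually_lt_const hε] with n hR hn ω hω
  have h1 := hθhat n ω hR
  have h2 := mul_lt_mul_of_pos_right hn (inv_pos.2 hR)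
  rw [mem_ofPred_eq, abs_of_pos (inv_pos.2 hR)] at hω
  exact absurd hω (by linarith)

end Minimax

/-! ### Assembly of the theorem. -/

open Minimax in
theorem theorem1
    {𝔅 E : Type*} [NormedAddCommGroup 𝔅] [NormedSpace ℝ 𝔅] [CompleteSpace 𝔅]
    [AddCommGroup E] [Module ℝ E]
    -- the parameter space, the index set with its topology, the population functions
    (Θ : Set 𝔅) (T : Set E) [TopologicalSpace T] (v : 𝔅 → E → ℝ)
    -- the rate, the underlying probability spaces, the estimators, and the empirical process
    (r : ℕ → ℝ) {Ω : ℕ → Type*} [∀ n, MeasurableSpace (Ω n)] (P : ∀ n, Measure (Ω n))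
    [∀ n, IsProbabilityMeasure (P n)] (vn : ∀ n, Ω n → 𝔅 → E → ℝ)
    (Gn : ∀ n, Ω n → LInf Θ T)
    -- the limit process
    {Ω' : Type*} [MeasurableSpace Ω'] (Q : Measure Ω') [IsProbabilityMeasure Q]
    [MeasurableSpace (LInf Θ T)] [BorelSpace (LInf Θ T)] (G : Ω' → LInf Θ T)
    -- the pseudometric, the approximating functionals and the error function
    (ρ : PseudoMetric (Θ × T) ℝ) (D : 𝔅 → E → 𝔅 → ℝ) (fv : ℝ → ℝ)
    -- compactness, local convexity, and the criterion function
    (hΘ_ne : Θ.Nonempty) (hΘ_compact : IsCompact Θ)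
    (hΘ_locConvex : ∀ θ ∈ identifiedSet Θ T v, ∃ ε : ℝ, 0 < ε ∧ Convex ℝ (Θ ∩ Metric.ball θ ε))
    (hT_ne : T.Nonempty) (hT_convex : Convex ℝ T)
    (hl_bdd : ∀ θ ∈ Θ, BddAbove (range fun t : T => v θ t))
    (hl_nonneg : ∀ θ ∈ Θ, 0 ≤ criterion T v θ)
    (hl_lsc : LowerSemicontinuousOn (criterion T v) Θ)
    -- weak convergence and asymptotic equicontinuity of the empirical process
    (hr : Tendsto r atTop atTop)
    (hGn : ∀ (n : ℕ) (ω : Ω n) (x : Θ × T), Gn n ω x = r n * (vn n ω x.1 x.2 - v x.1 x.2))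
    (hG_meas : Measurable G) (hG_tight : IsTightMeasureSet {Q.map G})
    (hG_weak : WeakConv P Gn Q G)
    (hG_equi : AsympEquicont P Gn ρ)
    -- positive homogeneous convex approximation and quasi-concavity
    (hD_lsc : ∀ θ ∈ identifiedSet Θ T v, ∀ t ∈ T, LowerSemicontinuous (D θ t))
    (hD_convex : ∀ θ ∈ identifiedSet Θ T v, ∀ t ∈ T, ConvexOn ℝ univ (D θ t))
    (hD_hom : ∀ θ ∈ identifiedSet Θ T v, ∀ t ∈ T, PosHomogeneous (D θ t))
    (hfv : fv =o[𝓝[>] 0] (fun δ : ℝ => δ))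
    (hD_approx : ∃ C : ℝ, ∀ᶠ δ in 𝓝[>] (0 : ℝ), ∀ θ ∈ identifiedSet Θ T v, ∀ θ' ∈ Θ, ∀ t ∈ T,
      ‖θ' - θ‖ ≤ δ → |v θ' t - v θ t - D θ t (θ' - θ)| ≤ C * |fv δ|)
    (hqc : ∀ n : ℕ, ∀ θ ∈ identifiedSet Θ T v, ∀ θ' ∈ Θ, ∀ᵐ ω ∂(P n),
      QuasiconcaveOn ℝ T (fun t => vn n ω θ t + D θ t (θ' - θ)))
    -- compactness of `T`, continuity of `ρ`, upper semicontinuity in `t`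
    (hT_compact : CompactSpace T) (hT_segments : SegmentsContinuous T)
    (hρ_cont : ∀ x : Θ × T, Tendsto (fun y => ρ y x) (𝓝 x) (𝓝 0))
    (hD_usc : ∀ θ ∈ identifiedSet Θ T v, ∀ θ' ∈ Θ,
      UpperSemicontinuous (fun t : T => D θ t (θ' - θ)))
    (hvn_usc : ∀ n : ℕ, ∀ θ ∈ identifiedSet Θ T v, ∀ θ' ∈ Θ, ∀ᵐ ω ∂(P n),
      UpperSemicontinuous (fun t : T => vn n ω θ t + D θ t (θ' - θ))) :
    -- the upper bound when `Θ₀` is nonempty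
    ((identifiedSet Θ T v).Nonempty →
      (∀ θ ∈ identifiedSet Θ T v, (K Θ T D θ).Nonempty) ∧
      LeAddOP P (stat Θ T r vn)
        (fun n ω => infSup (identifiedSet Θ T v) (K Θ T D) (Gn n ω)) (fun _ => 1) ∧
      WeakConv P (fun n ω => infSup (identifiedSet Θ T v) (K Θ T D) (Gn n ω))
        Q (fun ω => infSup (identifiedSet Θ T v) (K Θ T D) (G ω))) ∧
    -- divergence when `Θ₀` is empty
    (identifiedSet Θ T v = ∅ → IsBigOP P (fun n _ => r n) (stat Θ T r vn)) ∧
    -- if moreover `v θ` is upper semicontinuous for `θ ∈ Θ₀`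
    ((∀ θ ∈ identifiedSet Θ T v, UpperSemicontinuous (fun t : T => v θ t)) →
      (identifiedSet Θ T v).Nonempty →
      -- the upper bound holds with the smaller sets
      ((∀ θ ∈ identifiedSet Θ T v, (Ktilde Θ T v D θ).Nonempty) ∧
        LeAddOP P (stat Θ T r vn)
          (fun n ω => infSup (identifiedSet Θ T v) (Ktilde Θ T v D) (Gn n ω)) (fun _ => 1) ∧
        WeakConv P (fun n ω => infSup (identifiedSet Θ T v) (Ktilde Θ T v D) (Gn n ω))
          Q (fun ω => infSup (identifiedSet Θ T v) (Ktilde Θ T v D) (G ω))) ∧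
      -- and it is an equality under a rate condition or convexity of `v` near `Θ₀`
      (((∀ δ : ℝ, 0 ≤ δ → ContinuousWithinAt fv (Ici δ) δ) ∧
          (∃ θhat : ∀ n, Ω n → 𝔅, (∀ n ω, θhat n ω ∈ Θ) ∧
            IsLittleOP P (fun n ω => fv (Metric.infDist (θhat n ω) (identifiedSet Θ T v)))
              (fun n => (r n)⁻¹) ∧
            LeAddOP P (fun n ω => ⨆ t : T, vn n ω (θhat n ω) t)
              (fun n ω => ⨅ θ : Θ, ⨆ t : T, vn n ω θ t) (fun n => (r n)⁻¹)) ∨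
          (∀ θ ∈ identifiedSet Θ T v, ∃ ε : ℝ, 0 < ε ∧ ∀ t ∈ T,
            ConvexOn ℝ (Θ ∩ Metric.ball θ ε) (fun θ' => v θ' t))) →
        EqAddOP P (stat Θ T r vn)
          (fun n ω => infSup (identifiedSet Θ T v) (Ktilde Θ T v D) (Gn n ω)) (fun _ => 1) ∧
        WeakConv P (stat Θ T r vn)
          Q (fun ω => infSup (identifiedSet Θ T v) (Ktilde Θ T v D) (G ω)))) := by
  have : Nonempty T := hT_ne.to_subtype
  have hGb : ∀ η : ENNReal, 0 < η → ∃ L : ℝ, 0 < L ∧ ∀ᶠ n in atTop, P n {ω | L < ‖Gn n ω‖} ≤ η :=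
    fun η hη => hG_weak.exists_norm_le hG_meas hη
  have hDc : ∀ θ ∈ identifiedSet Θ T v, ∀ t ∈ T, Continuous (D θ t) := fun θ hθ t ht =>
    continuous_of_sublinear (hD_lsc θ hθ t ht) (hD_convex θ hθ t ht) (hD_hom θ hθ t ht)
  obtain ⟨ε₀, hε₀, hconv⟩ := exists_uniform_radius
    (isCompact_identifiedSet hΘ_compact hl_nonneg hl_lsc)
    (p := fun U => Convex ℝ (Θ ∩ U)) (fun θ ε θ' ε' hU h => by
      have := h.inter (convex_ball θ' ε')
      rwa [inter_assoc, inter_eq_right.2 hU] at this) hΘ_locConvex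
  -- The upper bound sees the index sets only through the shrinking of the almost active sets to
  -- them, so one argument covers `K` and `K̃`.
  have upper : ∀ A : 𝔅 → Set T, (identifiedSet Θ T v).Nonempty →
      (∀ θ ∈ identifiedSet Θ T v, ∀ U : Set T, (∀ t ∈ A θ, U ∈ 𝓝 t) →
        ∃ η > 0, almostActive Θ T v D θ ε₀ η ⊆ U) →
      (∀ θ ∈ identifiedSet Θ T v, (A θ).Nonempty) ∧
      (∀ ε : ℝ, 0 < ε → Tendsto (fun n => P n {ω | infSup (identifiedSet Θ T v) A (Gn n ω) + ε <
        stat Θ T r vn n ω}) atTop (𝓝 0)) ∧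
      Continuous (infSup (identifiedSet Θ T v) A : LInf Θ T → ℝ) := by
    intro A hne hA
    have hat := fun θ hθ => upper_bound_at (P := P) hΘ_compact hT_convex hT_segments hl_bdd
      hl_nonneg hr hGn hGb hG_equi hρ_cont hfv hD_approx hθ hε₀ (hconv θ hθ) (hDc θ hθ)
      (hD_convex θ hθ) (hD_hom θ hθ) (hD_usc θ hθ) (fun n => hqc n θ hθ) (fun n => hvn_usc n θ hθ)
      (hA θ hθ)
    obtain ⟨θ₀, hθ₀⟩ := hne
    have hAne : ∀ θ ∈ identifiedSet Θ T v, (A θ).Nonempty := fun θ hθ => (hat θ hθ).1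
    exact ⟨hAne, fun ε hε => tendsto_infSup_add_lt_stat hΘ_compact hG_equi hρ_cont
      ⟨θ₀, hθ₀, hθ₀.1⟩ (fun θ hθ _ => hAne θ hθ) (fun θ hθ => (hat θ hθ).2) hε,
      continuous_infSup ⟨θ₀, hθ₀, hθ₀.1⟩ fun θ hθ _ => hAne θ hθ⟩
  refine ⟨fun hne => ?_, isBigOP_stat_of_empty hΘ_ne hΘ_compact hl_bdd hl_nonneg hl_lsc hr hGn hGb,
    fun hv hne => ?_⟩
  · obtain ⟨h1, h2, h3⟩ := upper (K Θ T D) hne fun θ hθ U =>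
      exists_almostActive_subset_of_K hε₀ hθ.1 (hconv θ hθ) (hD_hom θ hθ) (hD_usc θ hθ)
    exact ⟨h1, leAddOP_of_tendsto h2, hG_weak.comp h3⟩
  · obtain ⟨h1, h2, h3⟩ := upper (Ktilde Θ T v D) hne fun θ hθ U =>
      exists_almostActive_subset_of_Ktilde hε₀ hθ.1 (hconv θ hθ) (hD_hom θ hθ) (hD_usc θ hθ)
        (hv θ hθ) fun t ht => le_zero_of_mem_identifiedSet hl_bdd hθ ht
    refine ⟨⟨h1, leAddOP_of_tendsto h2, hG_weak.comp h3⟩, fun hcase => ?_⟩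
    have lower : ∀ ε : ℝ, 0 < ε → Tendsto (fun n => P n {ω | stat Θ T r vn n ω + ε <
        infSup (identifiedSet Θ T v) (Ktilde Θ T v D) (Gn n ω)}) atTop (𝓝 0) := by
      rcases hcase with ⟨-, θhat, hθhat, hrate, hmin⟩ | hvconv
      · obtain ⟨κ₀, hκ₀, hneg⟩ := exists_tendsto_neg_of_isLittleOP hr hε₀ hconv hD_hom hD_approx
          hθhat hrate
        exact fun ε hε => tendsto_stat_add_lt_infSup hΘ_compact hl_bdd hl_nonneg hl_lsc hr hGn hGb
          hG_equi hρ_cont hne h1 hθhat (fun ε hε => tendsto_of_leAddOP hmin hε) hκ₀ hneg hε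
      · obtain ⟨θhat, hθhat, hmin⟩ := exists_near_minimizer (T := T) P hΘ_ne hr vn
        obtain ⟨ε₁, hε₁, hvc⟩ := exists_uniform_radius
          (isCompact_identifiedSet hΘ_compact hl_nonneg hl_lsc)
          (p := fun U => ∀ t ∈ T, ConvexOn ℝ (Θ ∩ U) fun θ' => v θ' t)
          (fun θ ε θ' ε' hU h t ht => (h t ht).subset (inter_subset_inter_right _ hU) (by
            have := (h t ht).1.inter (convex_ball θ' ε')
            rwa [inter_assoc, inter_eq_right.2 hU] at this)) hvconv
        exact fun ε hε => tendsto_stat_add_lt_infSup hΘ_compact hl_bdd hl_nonneg hl_lsc hr hGn hGb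
          hG_equi hρ_cont hne h1 hθhat hmin hε₁
          (exists_tendsto_neg_of_convexOn hfv hr hε₁ hvc hD_hom hD_approx hθhat) hε
    have heq := eqAddOP_of_tendsto h2 lower
    exact ⟨heq, (hG_weak.comp h3).of_eqAddOP (h3.measurable.comp hG_meas) heq⟩
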